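/- **Theorem (Empirical Distribution of $r$-Tuples).** Let $\mathcal{A}$ be a finite alphabet, let $\mathcal{M}(\mathcal{A})$ be the simplex of probability mass functions on $\mathcal{A}$, and let $\Pi$ be any probability measure on $\mathcal{M}(\mathcal{A})$. The *LZ78 source* with prior $\Pi$ is the following pair of processes $\mathbf{B} = (B_1, B_2, \dots)$ in $\mathcal{M}(\mathcal{A})$ and $\mathbf{X} = (X_1, X_2, \dots)$ in $\mathcal{A}$. Draw $\Theta_0, \Theta_1, \Theta_2, \dots$ i.i.d. with law $\Pi$, and grow a tree that initially consists of its root only, the root being the current node. For $t = 1, 2, \dots$: - if the current node has no $\Theta$ value yet, assign to it the next unused value of the sequence $\Theta_0, \Theta_1, \dots$; let $B_t$ be the $\Theta$ value of the current node; - conditionally on $\Theta_0, \Theta_1, \dots$ and $X_1, \dots, X_{t-1}$, draw $X_t$ from the probability mass function $B_t$; - if the current node has a child along the symbol $X_t$, move to this child; otherwise add this child as a new leaf and return to the root. Let $r$ be a natural number, and let $$L_n^{(r)} = \frac1n \sum_{i=1}^n \delta_{\left((B_i, \dots, B_{i+r-1}),\, (X_i, \dots, X_{i+r-1})\right)}$$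 be the empirical measure of $r$-tuples. Let $\eta_r^*$ be the law of $(\Theta^r, Y^r)$, where $\Theta^r = (\Theta_1, \dots, \Theta_r)$ is i.i.d. with law $\Pi$ and, conditionally on $\Theta^r$, the components of $Y^r = (Y_1, \dots, Y_r)$ are independent with $Y_i \sim \Theta_i$. Let $A$ be a *single-sequence event*, that is, a set of the form $$A = \left\{ (\theta^r, x^r) \in \mathcal{M}(\mathcal{A})^r \times \mathcal{A}^r \,:\, x^r = x_*^r \text{ and } \theta_i \in A_i \text{ for all } 1 \le i \le r \right\}$$ for some string $x_*^r \in \mathcal{A}^r$ and some measurable sets $A_1, \dots, A_r \subseteq \mathcal{M}(\mathcal{A})$. Then, almost surely, $$L_n^{(r)}(A) \longrightarrow \eta_r^*(A) \quad \text{as } n \to \infty.$$ In particular, the $r$-th order empirical distribution of $\mathbf{X}$ converges almost surely to the law of $r$ i.i.d. draws from the probability mass function $\mathbb{E}_{\Theta \sim \Pi}[\Theta]$: almost surely, for every $a^r = (a_1, \dots, a_r) \in \mathcal{A}^r$, $$\frac1n \sum_{i=1}^n \delta_{(X_i, \dots, X_{i+r-1})}(\{a^r\}) \longrightarrow \prod_{t=1}^r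 \mathbb{E}_{\Theta\sim\Pi}\big[\Theta[a_t]\big] \quad \text{as } n \to \infty.$$ -/

import Mathlib

open MeasureTheory ProbabilityTheory Filter Topology

namespace LZ78

/-! ### The LZ78 prefix tree

A node of the tree is identified with the word read along the path from the root to it; the root
is the empty word. Time is indexed from `0`: the symbol `x t` below is the `(t+1)`-st symbol. -/

/-- State of the incremental parsing: the nodes of the current prefix tree, the current node, and
the nodes that already carry a `Θ` value, in the order in which they received it (the `k`-th entry
of `visited` carries `Θ k`). -/
structure TreeState (𝒜 : Type*) where
  tree : Finset (List 𝒜)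
  node : List 𝒜
  visited : List (List 𝒜)

namespace TreeState

variable {𝒜 : Type*} [DecidableEq 𝒜]

/-- Before the first symbol: only the root, without a `Θ` value. -/
def init : TreeState 𝒜 where
  tree := {[]}
  node := []
  visited := []

/-- If the current node lacks a `Θ` value, assign to it the next one. -/
def assign (s : TreeState 𝒜) : TreeState 𝒜 :=
  if s.node ∈ s.visited then s else { s with visited := s.visited ++ [s.node] }

/-- Traverse the tree along the symbol `a`; if the child is missing, add it as a new leaf and
return to the root. -/
def traverse (s : TreeState 𝒜) (a : 𝒜) : TreeState 𝒜 :=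
  if s.node ++ [a] ∈ s.tree then { s with node := s.node ++ [a] }
  else { s with tree := insert (s.node ++ [a]) s.tree, node := [] }

/-- The state after the first `t` symbols of `x` have been processed. -/
def after (x : ℕ → 𝒜) : ℕ → TreeState 𝒜
  | 0 => init
  | t + 1 => (after x t).assign.traverse (x t)

end TreeState

/-- The index `k` of the value `Θ k` that is attached to the current node at time `t`, i.e. of the
value from which the symbol `x t` is to be drawn. It depends on `x 0, …, x (t - 1)` only. -/
def thetaIndex {𝒜 : Type*} [DecidableEq 𝒜] (x : ℕ → 𝒜) (t : ℕ) : ℕ :=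
  (TreeState.after x t).assign.visited.idxOf (TreeState.after x t).node

/-! ### The LZ78 source -/

section Source

variable {𝒜 : Type*} [Fintype 𝒜] [DecidableEq 𝒜]
  {Ω : Type*}

/-- The process `B`: the `Θ` value at the current node at time `t`. -/
def B (Θ : ℕ → Ω → stdSimplex ℝ 𝒜) (X : ℕ → Ω → 𝒜) (t : ℕ) (ω : Ω) : stdSimplex ℝ 𝒜 :=
  Θ (thetaIndex (fun s => X s ω) t) ω

/-- What has been generated before the symbol at time `t` is drawn: the values `Θ 0, Θ 1, …` and
the symbols `X 0, …, X (t - 1)` (and hence also `B 0, …, B t`). -/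
abbrev past [MeasurableSpace 𝒜] (Θ : ℕ → Ω → stdSimplex ℝ 𝒜) (X : ℕ → Ω → 𝒜) (t : ℕ) :
    MeasurableSpace Ω :=
  (⨆ i : ℕ, MeasurableSpace.comap (Θ i) inferInstance) ⊔
    ⨆ s : Fin t, MeasurableSpace.comap (X s) inferInstance

/-- The processes `Θ` and `X` on the probability space `(Ω, μ)` realize the LZ78 source with
prior `Pr` over the simplex: the `Θ i` are i.i.d. with law `Pr` and, conditioned on everything
generated before, the symbol at time `t` is drawn from the probability mass function `B t`. -/
structure IsSource [MeasurableSpace 𝒜] [MeasurableSpace Ω] (Pr : Measure (stdSimplex ℝ 𝒜))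
    (μ : Measure Ω) (Θ : ℕ → Ω → stdSimplex ℝ 𝒜) (X : ℕ → Ω → 𝒜) : Prop where
  measurable_theta : ∀ i, Measurable (Θ i)
  measurable_symbol : ∀ t, Measurable (X t)
  indep_theta : iIndepFun Θ μ
  law_theta : ∀ i, μ.map (Θ i) = Pr
  cond_symbol : ∀ (t : ℕ) (a : 𝒜),
    μ[(X t ⁻¹' {a}).indicator (fun _ => (1 : ℝ)) | past Θ X t] =ᵐ[μ]
      fun ω => B Θ X t ω a

end Source

/-! ### Empirical measures and their limit -/

section Measures

variable {𝒜 : Type*} [Fintype 𝒜] [MeasurableSpace 𝒜]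

/-- The law on the alphabet with probability mass function `θ`. -/
noncomputable def symbolLaw (θ : stdSimplex ℝ 𝒜) : Measure 𝒜 :=
  ∑ a, ENNReal.ofReal (θ a) • Measure.dirac a

instance (θ : stdSimplex ℝ 𝒜) : IsProbabilityMeasure (symbolLaw θ) := by
  constructor
  simp only [symbolLaw, Measure.coe_finsetSum, Finset.sum_apply, Measure.smul_apply,
    measure_univ, smul_eq_mul, mul_one]
  have h1 : ∑ a, θ a = 1 := θ.2.2
  have h0 : ∀ a, 0 ≤ θ a := θ.2.1
  rw [← ENNReal.ofReal_sum_of_nonneg (fun a _ => h0 a), h1, ENNReal.ofReal_one]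

lemma symbolLaw_singleton [MeasurableSingletonClass 𝒜] (θ : stdSimplex ℝ 𝒜) (a : 𝒜) :
    symbolLaw θ {a} = ENNReal.ofReal (θ a) := by
  classical
  simp [symbolLaw, Set.indicator_apply]

variable [MeasurableSingletonClass 𝒜]

lemma measurable_pi_symbolLaw (r : ℕ) :
    Measurable fun θ : Fin r → stdSimplex ℝ 𝒜 => Measure.pi fun i => symbolLaw (θ i) := by
  classical
  refine Measure.measurable_of_measurable_coe _ fun s _ => ?_
  have h : ∀ θ : Fin r → stdSimplex ℝ 𝒜, (Measure.pi fun i => symbolLaw (θ i)) s =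
      ∑ y : Fin r → 𝒜, if y ∈ s then ∏ i, ENNReal.ofReal (θ i (y i)) else 0 := by
    intro θ
    rw [← Finset.sum_filter]
    have hs : s = ((Finset.univ.filter fun y => y ∈ s : Finset (Fin r → 𝒜)) : Set (Fin r → 𝒜)) := by
      ext y; simp
    conv_lhs => rw [hs]
    rw [← sum_measure_singleton]
    refine Finset.sum_congr rfl fun y _ => ?_
    rw [Measure.pi_singleton]
    simp only [symbolLaw_singleton]
  simp_rw [h]
  refine Finset.measurable_sum _ fun y _ => ?_
  split_ifs
  · refine Finset.measurable_prod _ fun i _ => ENNReal.measurable_ofReal.comp ?_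
    exact (measurable_pi_apply (y i)).comp (measurable_subtype_coe.comp (measurable_pi_apply i))
  · exact measurable_const

/-- Given `r` probability mass functions `θ i`, draw independent symbols `Y i ∼ θ i`. -/
noncomputable def tupleKernel (r : ℕ) : Kernel (Fin r → stdSimplex ℝ 𝒜) (Fin r → 𝒜) where
  toFun θ := Measure.pi fun i => symbolLaw (θ i)
  measurable' := measurable_pi_symbolLaw r

instance (r : ℕ) : IsMarkovKernel (tupleKernel (𝒜 := 𝒜) r) :=
  ⟨fun θ => inferInstanceAs (IsProbabilityMeasure (Measure.pi fun i => symbolLaw (θ i)))⟩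

/-- The asymptotic law of the pair of `r`-tuples `(Θ, Y)`: the `Θ i` are i.i.d. with law `Pr` and,
given `Θ`, the `Y i` are independent with `Y i ∼ Θ i`. -/
noncomputable def limitLaw (Pr : Measure (stdSimplex ℝ 𝒜)) (r : ℕ) :
    Measure ((Fin r → stdSimplex ℝ 𝒜) × (Fin r → 𝒜)) :=
  (Measure.pi fun _ : Fin r => Pr) ⊗ₘ tupleKernel r

end Measures

/-- The empirical measure of the `r`-tuples of consecutive terms of the sequence `u` that start at
one of the first `n` times. -/
noncomputable def tupleMeasure {E : Type*} [MeasurableSpace E] (r n : ℕ) (u : ℕ → E) :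
    Measure (Fin r → E) :=
  (n : ENNReal)⁻¹ • ∑ i ∈ Finset.range n, Measure.dirac fun j : Fin r => u (i + j)

/-- The empirical measure of the pairs of `r`-tuples
`((b i, …, b (i + r - 1)), (x i, …, x (i + r - 1)))` that start at one of the first `n` times. -/
noncomputable def pairTupleMeasure {E F : Type*} [MeasurableSpace E] [MeasurableSpace F] (r n : ℕ)
    (b : ℕ → E) (x : ℕ → F) : Measure ((Fin r → E) × (Fin r → F)) :=
  (n : ENNReal)⁻¹ • ∑ i ∈ Finset.range n,
    Measure.dirac (fun j : Fin r => b (i + j), fun j : Fin r => x (i + j))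

/-- Single-sequence events: a fixed symbol string, and a measurable constraint on each of the
`Θ` values. -/
def IsSingleSequenceEvent {𝒜 : Type*} [Fintype 𝒜] {r : ℕ}
    (A : Set ((Fin r → stdSimplex ℝ 𝒜) × (Fin r → 𝒜))) : Prop :=
  ∃ (x : Fin r → 𝒜) (S : Fin r → Set (stdSimplex ℝ 𝒜)),
    (∀ i, MeasurableSet (S i)) ∧ A = {p | p.2 = x ∧ ∀ i, p.1 i ∈ S i}

end LZ78

/-! Induction on `r`: appending a symbol `z` with constraint `S` to the pattern must multiply the
limiting frequency by `c`, the mean under the prior of `f(θ) = 1_S(θ) θ(z)`. At a node of depth at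
least `r`, whether the preceding `r`-tuple matches is a function `γ` of the node and of the values
at its strict ancestors (`current_suffixInd`). Shallow nodes occur only `o(n)` times, since there
are `o(n)` phrases. So it suffices that `∑ γ(node) (match - c) = o(n)`. Replacing the match by its
conditional mean `f(B t)` costs a martingale with bounded increments (`ae_tendsto_sum_div`). The
difficulty is the remaining sum `∑ γ(node) (f(B t) - c)`: the same values are met again and again,
so its terms are not fresh.

Revisits are averaged phrase by phrase. A phrase is a walk from the root whose transition
probabilities are the values at the nodes, so the expected sum of `F` along it is `∑ p(v) F(v)` over
the nodes carrying values, with `p(v)` the probability of the path to `v`. By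
`abs_sum_current_sub_le`, the sum of `F` over time equals the sum of these expectations over
phrases, up to a martingale and an error of order `√n` plus the number of phrases. The martingale's
increments may be of order `√n`, but a telescoping argument bounds its second moment by `O(n^(3/2))`
(`integral_sq_sum_deviation_le`), which makes it `o(n)` along fourth powers.

It remains to compare `∑ p(v) γ(v) (f(θ_v) - c)` with `H = ∑ p(v)`. The value `θ_v` is independent
of all that precedes the first visit to `v`, while `p(v)` and `γ(v)` involve strict ancestors only.
In order of first visits this sum is therefore a martingale. With increments divided by `1 + H` it
is bounded in L² and converges, and summation by parts yields the bound `ε H + C`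
(`ae_weighted_sum_le`). Summed over phrases, `C` contributes `o(n)`. The sum of `H` is the expected
total length of the phrases, the case `F = 1`, hence `n + o(n)` along fourth powers. -/

namespace LZ78

set_option linter.unusedSectionVars false

/-! ### Combinatorics of the tree: labels, depths and number of phrases -/

section Combinatorics

variable {𝒜 : Type*} [DecidableEq 𝒜]

/-- The current node at time `t`. -/
def nodeAt (x : ℕ → 𝒜) (t : ℕ) : List 𝒜 := (TreeState.after x t).node

/-- The nodes of the tree at time `t`. -/
def treeAt (x : ℕ → 𝒜) (t : ℕ) : Finset (List 𝒜) := (TreeState.after x t).tree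

/-- The nodes that carry a value before the current node at time `t` is dealt with. -/
def oldNodes (x : ℕ → 𝒜) (t : ℕ) : List (List 𝒜) := (TreeState.after x t).visited

/-- The nodes that carry a value when the symbol at time `t` is drawn. -/
def labelled (x : ℕ → 𝒜) (t : ℕ) : List (List 𝒜) := (TreeState.after x t).assign.visited

/-- The symbol at time `t` ends a phrase. -/
def EndsPhrase (x : ℕ → 𝒜) (t : ℕ) : Prop := nodeAt x t ++ [x t] ∉ treeAt x t

instance (x : ℕ → 𝒜) (t : ℕ) : Decidable (EndsPhrase x t) :=
  inferInstanceAs (Decidable (_ ∉ _))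

/-- The current node at time `t` receives its value at this time. -/
def IsFresh (x : ℕ → 𝒜) (t : ℕ) : Prop := nodeAt x t ∉ oldNodes x t

instance (x : ℕ → 𝒜) (t : ℕ) : Decidable (IsFresh x t) :=
  inferInstanceAs (Decidable (_ ∉ _))

lemma TreeState.after_congr {x y : ℕ → 𝒜} {t : ℕ} (h : ∀ s < t, x s = y s) :
    after x t = after y t := by
  induction t with
  | zero => rfl
  | succ t ih => simp only [after]; rw [ih fun s hs => h s (by omega), h t (by omega)]

lemma TreeState.assign_tree (s : TreeState 𝒜) : s.assign.tree = s.tree := by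
  unfold assign; split_ifs <;> rfl

lemma TreeState.assign_node (s : TreeState 𝒜) : s.assign.node = s.node := by
  unfold assign; split_ifs <;> rfl

lemma TreeState.traverse_visited (s : TreeState 𝒜) (a : 𝒜) :
    (s.traverse a).visited = s.visited := by
  unfold traverse; split_ifs <;> rfl

variable (x : ℕ → 𝒜) (t : ℕ)

@[simp] lemma nodeAt_zero : nodeAt x 0 = [] := rfl
@[simp] lemma treeAt_zero : treeAt x 0 = {[]} := rfl
@[simp] lemma oldNodes_zero : oldNodes x 0 = [] := rfl
@[simp] lemma labelled_zero : labelled x 0 = [[]] := rfl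

lemma nodeAt_succ : nodeAt x (t + 1) = if EndsPhrase x t then [] else nodeAt x t ++ [x t] := by
  simp only [EndsPhrase, nodeAt, treeAt, TreeState.after, TreeState.traverse,
    TreeState.assign_tree, TreeState.assign_node]
  split_ifs <;> simp_all

lemma treeAt_succ : treeAt x (t + 1) = insert (nodeAt x t ++ [x t]) (treeAt x t) := by
  simp only [nodeAt, treeAt, TreeState.after, TreeState.traverse,
    TreeState.assign_tree, TreeState.assign_node]
  split_ifs with h
  · simp [h]
  · rfl

lemma oldNodes_succ : oldNodes x (t + 1) = labelled x t := by
  simp only [oldNodes, labelled, TreeState.after, TreeState.traverse_visited]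

lemma labelled_of_fresh (h : IsFresh x t) : labelled x t = oldNodes x t ++ [nodeAt x t] := by
  simp only [labelled, TreeState.assign]
  rw [if_neg (by exact h)]; rfl

lemma labelled_of_not_fresh (h : ¬ IsFresh x t) : labelled x t = oldNodes x t := by
  simp only [labelled, TreeState.assign]
  rw [if_pos (by exact not_not.1 h)]; rfl

lemma nodeAt_mem_labelled : nodeAt x t ∈ labelled x t := by
  by_cases h : IsFresh x t
  · simp [labelled_of_fresh x t h]
  · rw [labelled_of_not_fresh x t h]; simpa [IsFresh] using h

lemma oldNodes_prefix_labelled : oldNodes x t <+: labelled x t := by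
  by_cases h : IsFresh x t
  · rw [labelled_of_fresh x t h]; exact List.prefix_append _ _
  · rw [labelled_of_not_fresh x t h]

lemma nodup_labelled : (labelled x t).Nodup := by
  induction t with
  | zero => simp
  | succ t ih =>
    by_cases h : IsFresh x (t + 1)
    · rw [labelled_of_fresh x _ h, oldNodes_succ, List.nodup_append]
      refine ⟨ih, by simp, fun a ha b hb => ?_⟩
      rintro rfl
      rw [List.mem_singleton] at hb
      subst hb
      rw [IsFresh, oldNodes_succ] at h
      exact h ha
    · rwa [labelled_of_not_fresh x _ h, oldNodes_succ]

lemma nodeAt_mem_treeAt : nodeAt x t ∈ treeAt x t := by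
  have h0 : ∀ t, [] ∈ treeAt x t := fun t => by
    induction t with
    | zero => simp
    | succ t ih => rw [treeAt_succ]; exact Finset.mem_insert_of_mem ih
  cases t with
  | zero => simp
  | succ t =>
    rw [nodeAt_succ]
    split_ifs
    · exact h0 _
    · rw [treeAt_succ]; exact Finset.mem_insert_self _ _

lemma labelled_subset_treeAt {v : List 𝒜} (hv : v ∈ labelled x t) : v ∈ treeAt x t := by
  induction t with
  | zero => simpa using hv
  | succ t ih =>
    by_cases h : IsFresh x (t + 1)
    · rw [labelled_of_fresh x _ h, oldNodes_succ, List.mem_append, List.mem_singleton] at hv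
      rcases hv with hv | rfl
      · rw [treeAt_succ]; exact Finset.mem_insert_of_mem (ih hv)
      · exact nodeAt_mem_treeAt x _
    · rw [labelled_of_not_fresh x _ h, oldNodes_succ] at hv
      rw [treeAt_succ]; exact Finset.mem_insert_of_mem (ih hv)

/-- The set of nodes that carry a value is closed under taking parents. -/
lemma mem_labelled_of_append {v l : List 𝒜} (hv : v ++ l ∈ labelled x t) : v ∈ labelled x t := by
  have key : ∀ t (v : List 𝒜) a, v ++ [a] ∈ labelled x t → v ∈ labelled x t := by
    intro t
    induction t with
    | zero => simp
    | succ t ih =>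
      intro v a hv
      have hsub : ∀ u ∈ labelled x t, u ∈ labelled x (t + 1) := fun u hu =>
        (oldNodes_prefix_labelled x (t + 1)).subset (by rwa [oldNodes_succ])
      by_cases h : IsFresh x (t + 1)
      · rw [labelled_of_fresh x _ h, oldNodes_succ, List.mem_append, List.mem_singleton] at hv
        rcases hv with hv | hv
        · exact hsub _ (ih v a hv)
        · rw [nodeAt_succ] at hv
          split_ifs at hv
          · simp at hv
          · obtain ⟨rfl, -⟩ := List.append_inj' hv rfl
            exact hsub _ (nodeAt_mem_labelled x t)
      · rw [labelled_of_not_fresh x _ h, oldNodes_succ] at hv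
        exact hsub _ (ih v a hv)
  induction l using List.reverseRecOn with
  | nil => simpa using hv
  | append_singleton l a ih =>
    rw [← List.append_assoc] at hv
    exact ih (key t _ a hv)

lemma mem_toFinset_of_append (v l : List 𝒜) (h : v ++ l ∈ (labelled x t).toFinset) :
    v ∈ (labelled x t).toFinset := by
  rw [List.mem_toFinset] at *
  exact mem_labelled_of_append x t h

/-- Strict ancestors of the current node already carry a value. -/
lemma mem_oldNodes_of_append {v l : List 𝒜} (hl : l ≠ []) (hv : v ++ l = nodeAt x t) :
    v ∈ oldNodes x t := by
  have h1 : v ∈ labelled x t := mem_labelled_of_append x t (hv ▸ nodeAt_mem_labelled x t)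
  by_cases h : IsFresh x t
  · rw [labelled_of_fresh x _ h, List.mem_append, List.mem_singleton] at h1
    rcases h1 with h1 | h1
    · exact h1
    · rw [← h1] at hv; exact absurd (by simpa using hv) hl
  · rwa [labelled_of_not_fresh x _ h] at h1

lemma card_treeAt_succ :
    (treeAt x (t + 1)).card = (treeAt x t).card + if EndsPhrase x t then 1 else 0 := by
  rw [treeAt_succ]
  split_ifs with h
  · exact Finset.card_insert_of_notMem h
  · rw [Finset.insert_eq_of_mem (by simpa [EndsPhrase] using h)]; rfl

lemma card_endsPhrase_lt (n : ℕ) :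
    ∑ t ∈ Finset.range n, (if EndsPhrase x t then 1 else 0) + 1 = (treeAt x n).card := by
  induction n with
  | zero => simp
  | succ n ih => rw [Finset.sum_range_succ, card_treeAt_succ, ← ih]; omega

/-- Each fresh time appends one entry to the duplicate-free list `labelled`, all of whose entries
are nodes of the tree. -/
lemma card_isFresh_le (n : ℕ) :
    ∑ t ∈ Finset.range (n + 1), (if IsFresh x t then 1 else 0) ≤ (treeAt x n).card := by
  have h1 : ∀ n, ∑ t ∈ Finset.range (n + 1), (if IsFresh x t then 1 else 0)
      = (labelled x n).length := by
    intro n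
    induction n with
    | zero => simp [IsFresh]
    | succ n ih =>
      rw [Finset.sum_range_succ, ih]
      split_ifs with h
      · simp [labelled_of_fresh x _ h, oldNodes_succ]
      · simp [labelled_of_not_fresh x _ h, oldNodes_succ]
  rw [h1, ← List.toFinset_card_of_nodup (nodup_labelled x n)]
  refine Finset.card_le_card fun v hv => labelled_subset_treeAt x n (by simpa using hv)

/-- A node of depth `d` requires `d (d + 1) / 2` symbols. -/
lemma length_mul_length_le {v : List 𝒜} (hv : v ∈ treeAt x t) :
    v.length * (v.length + 1) + 2 * (nodeAt x t).length ≤ 2 * t := by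
  induction t generalizing v with
  | zero => simp_all
  | succ t ih =>
    -- The term `2 * (nodeAt x t).length` carries the induction: a new leaf below a node of depth
    -- `d` needs `(d + 1) * (d + 2) = d * (d + 1) + 2 * d + 2`, and the hypothesis at the current
    -- node itself bounds the first two terms.
    have hw := ih (nodeAt_mem_treeAt x t)
    rw [treeAt_succ, Finset.mem_insert] at hv
    rw [nodeAt_succ]
    split_ifs with h
    · rcases hv with rfl | hv
      · simp only [List.length_append, List.length_cons, List.length_nil]; nlinarith
      · have := ih hv; simp only [List.length_nil]; omega
    · have hv : v ∈ treeAt x t := by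
        rcases hv with rfl | hv
        · simpa [EndsPhrase] using h
        · exact hv
      have := ih hv
      simp only [List.length_append, List.length_cons, List.length_nil]; omega

lemma length_le_sqrt {v : List 𝒜} (hv : v ∈ treeAt x t) : v.length ≤ Nat.sqrt (2 * t) := by
  rw [Nat.le_sqrt]; have := length_mul_length_le x t hv; nlinarith

/-- The non-root nodes are the completed phrases, which together with the unfinished one partition
the text. -/
lemma sum_length_treeAt : ∑ v ∈ treeAt x t, v.length + (nodeAt x t).length = t := by
  induction t with
  | zero => simp
  | succ t ih =>
    rw [treeAt_succ, nodeAt_succ]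
    split_ifs with h
    · rw [Finset.sum_insert h]; simp; omega
    · rw [Finset.insert_eq_of_mem (by simpa [EndsPhrase] using h)]; simp; omega

lemma card_shallow_le (r n : ℕ) :
    ∑ t ∈ Finset.range n, (if (nodeAt x t).length < r then 1 else 0) ≤ r * (treeAt x n).card := by
  -- A phrase has at most `r` shallow times. The term `min (nodeAt x n).length r` counts those
  -- already used by the unfinished phrase, and the `+ r` offsets the root, which is in the tree
  -- from the start.
  suffices h : ∑ t ∈ Finset.range n, (if (nodeAt x t).length < r then 1 else 0) + r
      ≤ r * (treeAt x n).card + min (nodeAt x n).length r by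
    have := min_le_right (nodeAt x n).length r; omega
  induction n with
  | zero => simp
  | succ n ih =>
    rw [Finset.sum_range_succ, card_treeAt_succ, nodeAt_succ]
    split_ifs at * with h1 h2 h2 <;>
      simp only [mul_add, mul_one, mul_zero, List.length_append, List.length_cons,
        List.length_nil] <;> omega

/-- Over a finite alphabet, all but boundedly many nodes are deeper than `d`; as the depths sum to
at most `n`, there are at most `n / (d + 1)` such deep nodes, for every `d`. -/
lemma tendsto_card_treeAt_div [Finite 𝒜] :
    Tendsto (fun n : ℕ => ((treeAt x n).card : ℝ) / n) atTop (𝓝 0) := by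
  have key : ∀ d n : ℕ, ((treeAt x n).card : ℝ) * (d + 1) ≤
      (List.finite_length_le 𝒜 d).toFinset.card * (d + 1) + n := by
    intro d n
    have h1 : (treeAt x n).card ≤ (List.finite_length_le 𝒜 d).toFinset.card
        + ((treeAt x n).filter fun v => d + 1 ≤ v.length).card := by
      rw [← Finset.card_filter_add_card_filter_not (fun v : List 𝒜 => v.length ≤ d)]
      refine add_le_add (Finset.card_le_card fun v hv => ?_) (Finset.card_le_card fun v hv => ?_)
      · simpa using (Finset.mem_filter.1 hv).2
      · simp only [Finset.mem_filter, not_le] at hv ⊢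
        exact ⟨hv.1, hv.2⟩
    have h2 : ((treeAt x n).filter fun v => d + 1 ≤ v.length).card * (d + 1) ≤ n := by
      calc _ ≤ ∑ v ∈ (treeAt x n).filter (fun v => d + 1 ≤ v.length), v.length := by
            rw [← smul_eq_mul]
            exact Finset.card_nsmul_le_sum _ _ _ fun v hv => (Finset.mem_filter.1 hv).2
        _ ≤ ∑ v ∈ treeAt x n, v.length :=
            Finset.sum_le_sum_of_subset (Finset.filter_subset _ _)
        _ ≤ n := by have := sum_length_treeAt x n; omega
    have h3 : (treeAt x n).card * (d + 1)
        ≤ (List.finite_length_le 𝒜 d).toFinset.card * (d + 1) + n := by nlinarith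
    exact_mod_cast h3
  rw [Metric.tendsto_atTop]
  intro ε hε
  -- Half of `ε * n` pays for the deep nodes, by the choice of `d`; the other half pays for the
  -- shallow ones, by the choice of `N`.
  obtain ⟨d, hd⟩ := exists_nat_gt (2 / ε)
  obtain ⟨N, hN⟩ := exists_nat_gt (2 * ((List.finite_length_le 𝒜 d).toFinset.card : ℝ) / ε)
  refine ⟨N + 1, fun n hn => ?_⟩
  have hn' : (N : ℝ) + 1 ≤ n := by exact_mod_cast hn
  have hN0 : (0 : ℝ) ≤ N := by positivity
  have hn0 : (0 : ℝ) < n := by linarith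
  rw [Real.dist_eq, sub_zero, abs_of_nonneg (by positivity), div_lt_iff₀ hn0]
  have hd0 : (0 : ℝ) ≤ d := by positivity
  rw [div_lt_iff₀ hε] at hd hN
  set K : ℝ := ((List.finite_length_le 𝒜 d).toFinset.card : ℝ)
  have := key d n
  have h4 : (n : ℝ) ≤ ε * n / 2 * (d + 1) := by nlinarith
  have h5 : K < ε * n / 2 := by nlinarith
  have h6 : ((treeAt x n).card : ℝ) * (d + 1) < ε * n * (d + 1) := by nlinarith
  exact lt_of_mul_lt_mul_right h6 (by positivity)

end Combinatorics

/-! ### The potential of a phrase and the decomposition of sums over time -/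

section Potential

variable {𝒜 : Type*} [Fintype 𝒜]

/-- The probability that the walk started from the node `w`, with transition probabilities `ϑ`,
starts with the symbols `l`. -/
noncomputable def pathWeight (ϑ : List 𝒜 → stdSimplex ℝ 𝒜) : List 𝒜 → List 𝒜 → ℝ
  | _, [] => 1
  | w, a :: l => ϑ w a * pathWeight ϑ (w ++ [a]) l

variable {ϑ ϑ' : List 𝒜 → stdSimplex ℝ 𝒜}

lemma simplex_nonneg (θ : stdSimplex ℝ 𝒜) (a : 𝒜) : 0 ≤ θ a := θ.2.1 a
lemma simplex_sum (θ : stdSimplex ℝ 𝒜) : ∑ a, θ a = 1 := θ.2.2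
lemma simplex_le_one (θ : stdSimplex ℝ 𝒜) (a : 𝒜) : θ a ≤ 1 := by
  rw [← simplex_sum θ]
  exact Finset.single_le_sum (fun b _ => simplex_nonneg θ b) (Finset.mem_univ a)

lemma pathWeight_nonneg (ϑ : List 𝒜 → stdSimplex ℝ 𝒜) (w l : List 𝒜) :
    0 ≤ pathWeight ϑ w l := by
  induction l generalizing w with
  | nil => simp [pathWeight]
  | cons a l ih => exact mul_nonneg (simplex_nonneg _ _) (ih _)

lemma pathWeight_le_one (ϑ : List 𝒜 → stdSimplex ℝ 𝒜) (w l : List 𝒜) :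
    pathWeight ϑ w l ≤ 1 := by
  induction l generalizing w with
  | nil => simp [pathWeight]
  | cons a l ih => exact mul_le_one₀ (simplex_le_one _ _) (pathWeight_nonneg _ _ _) (ih _)

/-- The value at the endpoint `w ++ l` is not used. For this reason the weight of a fresh node is
known before its value is drawn. -/
lemma pathWeight_congr {w l : List 𝒜}
    (h : ∀ l₁ l₂, l₂ ≠ [] → l₁ ++ l₂ = l → ϑ (w ++ l₁) = ϑ' (w ++ l₁)) :
    pathWeight ϑ w l = pathWeight ϑ' w l := by
  induction l generalizing w with
  | nil => rfl
  | cons a l ih =>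
    simp only [pathWeight]
    rw [ih fun l₁ l₂ h2 h3 => by simpa using h (a :: l₁) l₂ h2 (by simp [h3])]
    have := h [] (a :: l) (by simp) rfl
    simp only [List.append_nil] at this
    rw [this]

variable [DecidableEq 𝒜] {V : Finset (List 𝒜)} {F F' : List 𝒜 → ℝ} {w : List 𝒜}

/-- The expected sum of `F` over the nodes in `V` that are visited by the walk with transition
probabilities `ϑ` which starts from the node `w`. -/
noncomputable def potential (ϑ : List 𝒜 → stdSimplex ℝ 𝒜) (V : Finset (List 𝒜))
    (F : List 𝒜 → ℝ) (w : List 𝒜) : ℝ :=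
  ∑ v ∈ V, if w <+: v then pathWeight ϑ w (v.drop w.length) * F v else 0

lemma potential_nonneg (hF : ∀ v, 0 ≤ F v) : 0 ≤ potential ϑ V F w :=
  Finset.sum_nonneg fun v _ => by
    split_ifs
    · exact mul_nonneg (pathWeight_nonneg _ _ _) (hF v)
    · rfl

lemma potential_of_notMem (hV : ∀ v l, v ++ l ∈ V → v ∈ V) (hw : w ∉ V) :
    potential ϑ V F w = 0 := by
  refine Finset.sum_eq_zero fun v hv => if_neg ?_
  rintro ⟨l, rfl⟩
  exact hw (hV w l hv)

/-- First-step analysis of the walk. -/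
lemma potential_of_mem (hw : w ∈ V) :
    potential ϑ V F w = F w + ∑ a, ϑ w a * potential ϑ V F (w ++ [a]) := by
  have h1 : F w = ∑ v ∈ V, if v = w then F v else 0 := by simp [hw]
  simp only [potential, Finset.mul_sum]
  rw [Finset.sum_comm]
  conv_rhs => rw [h1, ← Finset.sum_add_distrib]
  refine Finset.sum_congr rfl fun v _ => ?_
  by_cases hv : w <+: v
  · obtain ⟨l, rfl⟩ := hv
    cases l with
    | nil =>
      have h2 : ∀ a, ¬ w ++ [a] <+: w := fun a h => by have := h.length_le; simp at this
      simp [pathWeight, h2]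
    | cons b l =>
      have h2 : ∀ a, w ++ [a] <+: w ++ b :: l ↔ a = b := fun a => by
        rw [List.prefix_append_right_inj, List.cons_prefix_cons]; simp
      simp [h2, pathWeight, mul_assoc]
  · have h2 : ∀ a, ¬ w ++ [a] <+: v := fun a h => hv ((List.prefix_append _ _).trans h)
    have h3 : v ≠ w := by rintro rfl; exact hv (List.prefix_refl _)
    simp [h2, h3, hv]

/-- The walk meets one node per depth. The induction runs over the number `k` of levels left below
`w`. -/
lemma potential_le {m : ℕ} (hV : ∀ v l, v ++ l ∈ V → v ∈ V) (hm : ∀ v ∈ V, v.length ≤ m)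
    (hF : ∀ v, F v ≤ 1) : potential ϑ V F w ≤ m + 1 := by
  have key : ∀ (k : ℕ) (w : List 𝒜), m + 1 ≤ w.length + k → potential ϑ V F w ≤ k := by
    intro k
    induction k with
    | zero =>
      intro w hw
      rw [potential_of_notMem hV fun h => by have := hm w h; omega]; simp
    | succ k ih =>
      intro w hw
      by_cases h : w ∈ V
      · rw [potential_of_mem h]
        have : ∑ a, ϑ w a * potential ϑ V F (w ++ [a]) ≤ ∑ a, ϑ w a * (k : ℝ) :=
          Finset.sum_le_sum fun a _ => mul_le_mul_of_nonneg_left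
            (ih _ (by simp; omega)) (simplex_nonneg _ _)
        rw [← Finset.sum_mul, simplex_sum] at this
        push_cast
        linarith [hF w]
      · rw [potential_of_notMem hV h]; positivity
  exact_mod_cast key (m + 1) w (by omega)

lemma potential_congr (hV : ∀ v l, v ++ l ∈ V → v ∈ V) (hϑ : ∀ v ∈ V, ϑ v = ϑ' v)
    (hF : ∀ v ∈ V, F v = F' v) : potential ϑ V F w = potential ϑ' V F' w := by
  refine Finset.sum_congr rfl fun v hv => ?_
  split_ifs with h
  · obtain ⟨l, rfl⟩ := h
    rw [hF _ hv, List.drop_left, pathWeight_congr fun l₁ l₂ _ hl => hϑ _ (hV _ l₂ ?_)]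
    rwa [List.append_assoc, hl]
  · rfl

/-- The values at the nodes, when the `k`-th node in the list `V` carries the value `θ k`. -/
def nodeTheta (V : List (List 𝒜)) (θ : ℕ → stdSimplex ℝ 𝒜) (v : List 𝒜) : stdSimplex ℝ 𝒜 :=
  θ (V.idxOf v)

/-- The values at the nodes when the symbol at time `t` is drawn. -/
def thetaAt (x : ℕ → 𝒜) (θ : ℕ → stdSimplex ℝ 𝒜) (t : ℕ) : List 𝒜 → stdSimplex ℝ 𝒜 :=
  nodeTheta (labelled x t) θ

/-- A function of a node that depends only on the values at this node and at its ancestors. -/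
def IsLocal (F : (List 𝒜 → stdSimplex ℝ 𝒜) → List 𝒜 → ℝ) : Prop :=
  ∀ ϑ ϑ' w, (∀ v, v <+: w → ϑ v = ϑ' v) → F ϑ w = F ϑ' w

lemma nodeTheta_of_prefix {V V' : List (List 𝒜)} (h : V <+: V') (θ : ℕ → stdSimplex ℝ 𝒜)
    {v : List 𝒜} (hv : v ∈ V) : nodeTheta V' θ v = nodeTheta V θ v := by
  obtain ⟨l, rfl⟩ := h
  simp [nodeTheta, List.idxOf_append_of_mem hv]

/-- The expected sum of `F` over the nodes still to be visited in the phrase, when the current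
node is `w` and the symbol at time `t` is about to be drawn. -/
noncomputable def remaining (F : (List 𝒜 → stdSimplex ℝ 𝒜) → List 𝒜 → ℝ) (x : ℕ → 𝒜)
    (θ : ℕ → stdSimplex ℝ 𝒜) (t : ℕ) (w : List 𝒜) : ℝ :=
  potential (thetaAt x θ t) (labelled x t).toFinset (F (thetaAt x θ t)) w

/-- The value of `F` at the current node. -/
noncomputable def current (F : (List 𝒜 → stdSimplex ℝ 𝒜) → List 𝒜 → ℝ) (x : ℕ → 𝒜)
    (θ : ℕ → stdSimplex ℝ 𝒜) (t : ℕ) : ℝ :=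
  F (thetaAt x θ t) (nodeAt x t)

/-- The deviation of the potential, if the symbol `a` is drawn at time `t`, from its
expectation. -/
noncomputable def deviation (F : (List 𝒜 → stdSimplex ℝ 𝒜) → List 𝒜 → ℝ) (a : 𝒜) (x : ℕ → 𝒜)
    (θ : ℕ → stdSimplex ℝ 𝒜) (t : ℕ) : ℝ :=
  remaining F x θ t (nodeAt x t ++ [a]) - (remaining F x θ t (nodeAt x t) - current F x θ t)

section Remaining

variable {F : (List 𝒜 → stdSimplex ℝ 𝒜) → List 𝒜 → ℝ} (x : ℕ → 𝒜) (θ : ℕ → stdSimplex ℝ 𝒜)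
  (t : ℕ) (w : List 𝒜)

lemma thetaAt_succ_of_mem {v : List 𝒜} (hv : v ∈ labelled x t) :
    thetaAt x θ (t + 1) v = thetaAt x θ t v :=
  nodeTheta_of_prefix (by rw [← oldNodes_succ]; exact oldNodes_prefix_labelled x (t + 1)) θ hv

lemma remaining_nonneg (hF : ∀ ϑ v, 0 ≤ F ϑ v) : 0 ≤ remaining F x θ t w :=
  potential_nonneg (hF _)

lemma remaining_le (hF : ∀ ϑ v, F ϑ v ≤ 1) :
    remaining F x θ t w ≤ Nat.sqrt (2 * t) + 1 :=
  potential_le (mem_toFinset_of_append x t)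
    (fun v hv => length_le_sqrt x t (labelled_subset_treeAt x t (by simpa using hv))) (hF _)

lemma sum_mul_remaining :
    ∑ a, thetaAt x θ t (nodeAt x t) a * remaining F x θ t (nodeAt x t ++ [a])
      = remaining F x θ t (nodeAt x t) - current F x θ t := by
  have := potential_of_mem (ϑ := thetaAt x θ t) (F := F (thetaAt x θ t))
    (List.mem_toFinset.2 (nodeAt_mem_labelled x t))
  simp only [remaining, current]
  rw [this]
  ring

/-- This makes `deviation` a martingale increment of the source. -/
lemma sum_mul_deviation : ∑ a, thetaAt x θ t (nodeAt x t) a * deviation F a x θ t = 0 := by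
  simp only [deviation, mul_sub, Finset.sum_sub_distrib, ← Finset.sum_mul, simplex_sum]
  simp only [← mul_sub, sum_mul_remaining]
  ring

/-- Values once assigned never change and `F` is local, so the potential changes only by the term of
a newly labelled node. -/
lemma remaining_succ (hF : IsLocal F) :
    remaining F x θ (t + 1) w = remaining F x θ t w +
      if IsFresh x (t + 1) ∧ w <+: nodeAt x (t + 1) then
        pathWeight (thetaAt x θ (t + 1)) w ((nodeAt x (t + 1)).drop w.length)
          * current F x θ (t + 1) else 0 := by
  have h1 : remaining F x θ t w
      = potential (thetaAt x θ (t + 1)) (labelled x t).toFinset (F (thetaAt x θ (t + 1))) w := by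
    refine potential_congr (mem_toFinset_of_append x t) (fun v hv => ?_) fun v hv => ?_
    · exact (thetaAt_succ_of_mem x θ t (by simpa using hv)).symm
    · refine hF _ _ _ fun u hu => (thetaAt_succ_of_mem x θ t ?_).symm
      obtain ⟨l, rfl⟩ := hu
      exact mem_labelled_of_append x t (by simpa using hv)
  rw [h1, remaining]
  by_cases h : IsFresh x (t + 1)
  · have h2 : (labelled x (t + 1)).toFinset
        = insert (nodeAt x (t + 1)) (labelled x t).toFinset := by
      rw [labelled_of_fresh x _ h, oldNodes_succ]; ext; simp [or_comm]
    rw [IsFresh, oldNodes_succ] at h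
    rw [h2, potential, Finset.sum_insert (by simpa using h), add_comm]
    simp only [IsFresh, oldNodes_succ, h, not_false_eq_true, true_and]
    rfl
  · simp [h, labelled_of_not_fresh x _ h, oldNodes_succ]

/-- What is added to the potential of the next node when the process moves to this node: the
potential of the root at the end of a phrase, and the value of `F` at a fresh node. -/
noncomputable def restart (F : (List 𝒜 → stdSimplex ℝ 𝒜) → List 𝒜 → ℝ) (x : ℕ → 𝒜)
    (θ : ℕ → stdSimplex ℝ 𝒜) (t : ℕ) : ℝ :=
  if EndsPhrase x t then remaining F x θ (t + 1) []
  else if IsFresh x (t + 1) then current F x θ (t + 1) else 0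

/-- At the end of a phrase the child lies outside the tree and has potential zero, so the potential
of the root is all gain. Otherwise the only possible gain is the new node itself, with weight `1`.
-/
lemma remaining_nodeAt_succ (hF : IsLocal F) :
    remaining F x θ (t + 1) (nodeAt x (t + 1))
      = remaining F x θ t (nodeAt x t ++ [x t]) + restart F x θ t := by
  by_cases h : EndsPhrase x t
  · have h1 : remaining F x θ t (nodeAt x t ++ [x t]) = 0 :=
      potential_of_notMem (mem_toFinset_of_append x t)
        fun h2 => h (labelled_subset_treeAt x t (by simpa using h2))
    simp [restart, h1, h, nodeAt_succ]
  · rw [remaining_succ _ _ _ _ hF, restart, if_neg h]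
    have h2 : nodeAt x (t + 1) = nodeAt x t ++ [x t] := by rw [nodeAt_succ, if_neg h]
    simp [h2, pathWeight]

/-- The potential at the current node telescopes: in each step it gains `deviation` and `restart`
and loses `current`. -/
lemma sum_current_add (hF : IsLocal F) (n : ℕ) :
    ∑ t ∈ Finset.range n, current F x θ t + remaining F x θ n (nodeAt x n)
      = ∑ t ∈ Finset.range n, deviation F (x t) x θ t + remaining F x θ 0 []
        + ∑ t ∈ Finset.range n, restart F x θ t := by
  induction n with
  | zero => simp
  | succ n ih =>
    simp only [Finset.sum_range_succ, remaining_nodeAt_succ x θ n hF, deviation] at *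
    linarith

lemma remaining_zero : remaining F x θ 0 [] = current F x θ 0 := by
  simp [remaining, potential, current, pathWeight]

/-- The sum of `F` over the times is the sum over the phrases of the expected sums of `F` over the
nodes of the phrase, up to a martingale and to a small error. -/
lemma abs_sum_current_sub_le (hF : IsLocal F) (h0 : ∀ ϑ v, 0 ≤ F ϑ v) (h1 : ∀ ϑ v, F ϑ v ≤ 1)
    (n : ℕ) :
    |∑ t ∈ Finset.range n, current F x θ t
      - (∑ t ∈ Finset.range n, if EndsPhrase x t then remaining F x θ (t + 1) [] else 0)
      - ∑ t ∈ Finset.range n, deviation F (x t) x θ t|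
      ≤ Nat.sqrt (2 * n) + 2 + (treeAt x n).card := by
  have hc0 : ∀ t, 0 ≤ current F x θ t := fun t => h0 _ _
  have hc1 : ∀ t, current F x θ t ≤ 1 := fun t => h1 _ _
  have h2 := sum_current_add x θ hF n
  rw [remaining_zero] at h2
  have h3 : ∑ t ∈ Finset.range n, restart F x θ t
      = (∑ t ∈ Finset.range n, if EndsPhrase x t then remaining F x θ (t + 1) [] else 0)
        + ∑ t ∈ Finset.range n, if EndsPhrase x t then 0 else
          if IsFresh x (t + 1) then current F x θ (t + 1) else 0 := by
    rw [← Finset.sum_add_distrib]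
    refine Finset.sum_congr rfl fun t _ => ?_
    rw [restart]; split_ifs <;> simp
  have h4 : (0 : ℝ) ≤ ∑ t ∈ Finset.range n, if EndsPhrase x t then 0 else
          if IsFresh x (t + 1) then current F x θ (t + 1) else 0 :=
    Finset.sum_nonneg fun t _ => by split_ifs <;> first | rfl | exact hc0 _
  -- Fresh nodes met inside a phrase are not foreseen by the potential, but each node is fresh only
  -- once.
  have h5 : (∑ t ∈ Finset.range n, if EndsPhrase x t then 0 else
          if IsFresh x (t + 1) then current F x θ (t + 1) else 0) ≤ ((treeAt x n).card : ℝ) := by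
    have := card_isFresh_le x n
    rw [Finset.sum_range_succ'] at this
    calc _ ≤ ∑ t ∈ Finset.range n, (((if IsFresh x (t + 1) then 1 else 0 : ℕ)) : ℝ) :=
          Finset.sum_le_sum fun t _ => by split_ifs <;> simp [hc1]
      _ ≤ _ := by rw [← Nat.cast_sum]; exact_mod_cast (Nat.le_add_right _ _).trans this
  have h6 := remaining_nonneg x θ n (nodeAt x n) h0
  have h7 := remaining_le x θ n (nodeAt x n) h1
  have := hc0 0
  have := hc1 0
  rw [abs_le]
  constructor <;> linarith

/-- Holds because `restart` is nonnegative; it lets the second moments of the deviations telescope.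
-/
lemma sq_remaining_le (hF : IsLocal F) (h0 : ∀ ϑ v, 0 ≤ F ϑ v) :
    remaining F x θ t (nodeAt x t ++ [x t]) ^ 2
      ≤ remaining F x θ (t + 1) (nodeAt x (t + 1)) ^ 2 := by
  have h1 : 0 ≤ restart F x θ t := by
    rw [restart]
    split_ifs
    · exact remaining_nonneg _ _ _ _ h0
    · exact h0 _ _
    · rfl
  have := remaining_nonneg x θ t (nodeAt x t ++ [x t]) h0
  rw [remaining_nodeAt_succ x θ t hF]
  exact pow_le_pow_left₀ this (by linarith) 2

/-- The probability of the node at time `t`, if it is fresh. -/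
noncomputable def freshWeight (x : ℕ → 𝒜) (θ : ℕ → stdSimplex ℝ 𝒜) (t : ℕ) : ℝ :=
  if IsFresh x t then pathWeight (nodeTheta (oldNodes x t) θ) [] (nodeAt x t) else 0

lemma thetaAt_of_strict {v l : List 𝒜} (hl : l ≠ []) (h : v ++ l = nodeAt x t) :
    thetaAt x θ t v = nodeTheta (oldNodes x t) θ v :=
  nodeTheta_of_prefix (oldNodes_prefix_labelled x t) θ (mem_oldNodes_of_append x t hl h)

/-- Every labelled node was fresh at exactly one time, and neither its weight nor its `F` has
changed since. A sum over nodes thus becomes a sum over times, to which martingale arguments apply.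
-/
lemma remaining_nil (hF : IsLocal F) :
    remaining F x θ t [] = ∑ s ∈ Finset.range (t + 1), freshWeight x θ s * current F x θ s := by
  induction t with
  | zero => rw [remaining_zero]; simp [freshWeight, IsFresh, pathWeight]
  | succ t ih =>
    rw [remaining_succ _ _ _ _ hF, Finset.sum_range_succ _ (t + 1), ih, freshWeight]
    congr 1
    by_cases h : IsFresh x (t + 1)
    · simp only [h, List.nil_prefix, and_self, if_true, List.length_nil, List.drop_zero]
      congr 1
      refine pathWeight_congr fun l₁ l₂ h1 h2 => ?_
      rw [List.nil_append]
      exact thetaAt_of_strict x θ _ h1 h2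
    · simp [h]

end Remaining

end Potential

/-! ### Measurable functions of past symbols and values -/

section History

variable {𝒜 : Type*} [Fintype 𝒜]

/-- A function of the symbols `x` and of the values `θ`, which depends measurably on `θ` and on no
other symbols than `x 0, …, x (t - 1)`. -/
structure IsHistory (t : ℕ) (Ψ : (ℕ → 𝒜) → (ℕ → stdSimplex ℝ 𝒜) → ℝ) : Prop where
  measurable : ∀ x, Measurable (Ψ x)
  congr : ∀ x y, (∀ s < t, x s = y s) → Ψ x = Ψ y

namespace IsHistory

variable {s t : ℕ} {Ψ Φ : (ℕ → 𝒜) → (ℕ → stdSimplex ℝ 𝒜) → ℝ}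

lemma mono (h : IsHistory s Ψ) (hst : s ≤ t) : IsHistory t Ψ :=
  ⟨h.measurable, fun x y hxy => h.congr x y fun i hi => hxy i (by omega)⟩

lemma mul (h : IsHistory t Ψ) (h' : IsHistory t Φ) :
    IsHistory t fun x θ => Ψ x θ * Φ x θ :=
  ⟨fun x => (h.measurable x).mul (h'.measurable x), fun x y hxy => by
    simp only [h.congr x y hxy, h'.congr x y hxy]⟩

lemma sub (h : IsHistory t Ψ) (h' : IsHistory t Φ) :
    IsHistory t fun x θ => Ψ x θ - Φ x θ :=
  ⟨fun x => (h.measurable x).sub (h'.measurable x), fun x y hxy => by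
    simp only [h.congr x y hxy, h'.congr x y hxy]⟩

lemma sum {ι : Type*} (u : Finset ι) {Ψ : ι → (ℕ → 𝒜) → (ℕ → stdSimplex ℝ 𝒜) → ℝ}
    (h : ∀ i ∈ u, IsHistory t (Ψ i)) : IsHistory t fun x θ => ∑ i ∈ u, Ψ i x θ :=
  ⟨fun x => Finset.measurable_sum _ fun i hi => (h i hi).measurable x, fun x y hxy => by
    funext θ
    exact Finset.sum_congr rfl fun i hi => by rw [(h i hi).congr x y hxy]⟩

lemma symbol {U : 𝒜 → (ℕ → 𝒜) → (ℕ → stdSimplex ℝ 𝒜) → ℝ} (h : ∀ a, IsHistory t (U a)) :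
    IsHistory (t + 1) fun x => U (x t) x :=
  ⟨fun x => (h (x t)).measurable x, fun x y hxy => by
    show U (x t) x = U (y t) y
    rw [hxy t (by omega)]
    exact (h _).congr x y fun i hi => hxy i (by omega)⟩

/-- Freezing the last symbol at `a` is how it gets integrated out. -/
lemma update [DecidableEq 𝒜] (h : IsHistory (t + 1) Ψ) (a : 𝒜) :
    IsHistory t fun x => Ψ (Function.update x t a) :=
  ⟨fun x => h.measurable _, fun x y hxy => h.congr _ _ fun s hs => by
    rcases eq_or_ne s t with rfl | hst
    · simp
    · rw [Function.update_of_ne hst, Function.update_of_ne hst]; exact hxy s (by omega)⟩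

variable [MeasurableSpace 𝒜] [MeasurableSingletonClass 𝒜]

/-- Joint measurability is automatic because only finitely many words of length `t` matter. The
default symbol after time `t` is irrelevant. -/
lemma measurable_comp [Nonempty 𝒜] (h : IsHistory t Ψ) {Ω : Type*} {m : MeasurableSpace Ω}
    {X : Ω → ℕ → 𝒜} {Θ : Ω → ℕ → stdSimplex ℝ 𝒜} (hX : ∀ s < t, Measurable fun ω => X ω s)
    (hΘ : Measurable Θ) : Measurable fun ω => Ψ (X ω) (Θ ω) := by
  classical
  let e : (Fin t → 𝒜) → ℕ → 𝒜 := fun y s =>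
    if hs : s < t then y ⟨s, hs⟩ else Classical.arbitrary 𝒜
  have h1 : Measurable fun p : (Fin t → 𝒜) × (ℕ → stdSimplex ℝ 𝒜) => Ψ (e p.1) p.2 :=
    measurable_from_prod_countable_right fun y => h.measurable (e y)
  have h2 : Measurable fun ω => ((fun i : Fin t => X ω i), Θ ω) :=
    (measurable_pi_lambda _ fun i : Fin t => hX i i.2).prodMk hΘ
  convert h1.comp h2 using 2 with ω
  exact congrFun (h.congr _ _ fun s hs => by simp [e, hs]) _

end IsHistory

lemma isHistory_of_after [DecidableEq 𝒜] {t : ℕ}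
    {G : TreeState 𝒜 → (ℕ → stdSimplex ℝ 𝒜) → ℝ} (hG : ∀ s, Measurable (G s)) :
    IsHistory t fun x => G (TreeState.after x t) :=
  ⟨fun x => hG _, fun x y hxy => by rw [TreeState.after_congr hxy]⟩

/-- A function of the node and of the values at this node and its ancestors, with values in the
unit interval. -/
structure IsNodeFunctional (F : (List 𝒜 → stdSimplex ℝ 𝒜) → List 𝒜 → ℝ) : Prop where
  nonneg : ∀ ϑ w, 0 ≤ F ϑ w
  le_one : ∀ ϑ w, F ϑ w ≤ 1
  isLocal : IsLocal F
  measurable : ∀ w, Measurable fun ϑ => F ϑ w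

variable [DecidableEq 𝒜] {F : (List 𝒜 → stdSimplex ℝ 𝒜) → List 𝒜 → ℝ}

lemma measurable_nodeTheta (V : List (List 𝒜)) :
    Measurable (nodeTheta V : (ℕ → stdSimplex ℝ 𝒜) → List 𝒜 → stdSimplex ℝ 𝒜) :=
  measurable_pi_lambda _ fun _ => measurable_pi_apply _

lemma measurable_simplex_apply (a : 𝒜) : Measurable fun θ : stdSimplex ℝ 𝒜 => θ a :=
  (measurable_pi_apply a).comp measurable_subtype_coe

lemma measurable_pathWeight (w l : List 𝒜) :
    Measurable fun ϑ : List 𝒜 → stdSimplex ℝ 𝒜 => pathWeight ϑ w l := by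
  induction l generalizing w with
  | nil => exact measurable_const
  | cons a l ih =>
    exact ((measurable_simplex_apply a).comp (measurable_pi_apply w)).mul (ih _)

lemma measurable_potential (hF : IsNodeFunctional F) (V : Finset (List 𝒜)) (w : List 𝒜) :
    Measurable fun ϑ => potential ϑ V (F ϑ) w := by
  refine Finset.measurable_sum _ fun v _ => ?_
  split_ifs
  · exact (measurable_pathWeight _ _).mul (hF.measurable v)
  · exact measurable_const

lemma IsNodeFunctional.isHistory_remaining (hF : IsNodeFunctional F) (t : ℕ)
    (l : List 𝒜) : IsHistory t fun x θ => remaining F x θ t (nodeAt x t ++ l) :=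
  isHistory_of_after (G := fun s θ => potential (nodeTheta s.assign.visited θ)
    s.assign.visited.toFinset (F (nodeTheta s.assign.visited θ)) (s.node ++ l))
    fun _ => (measurable_potential hF _ _).comp (measurable_nodeTheta _)

lemma IsNodeFunctional.isHistory_current (hF : IsNodeFunctional F) (t : ℕ) :
    IsHistory t fun x θ => current F x θ t :=
  isHistory_of_after (G := fun s θ => F (nodeTheta s.assign.visited θ) s.node)
    fun _ => (hF.measurable _).comp (measurable_nodeTheta _)

lemma IsNodeFunctional.isHistory_deviation (hF : IsNodeFunctional F) (t : ℕ) (a : 𝒜) :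
    IsHistory t fun x θ => deviation F a x θ t := by
  have := hF.isHistory_remaining t []
  simp only [List.append_nil] at this
  exact (hF.isHistory_remaining t [a]).sub (this.sub (hF.isHistory_current t))

lemma isHistory_thetaAt (t : ℕ) {f : stdSimplex ℝ 𝒜 → ℝ} (hf : Measurable f) :
    IsHistory t fun x θ => f (thetaAt x θ t (nodeAt x t)) :=
  isHistory_of_after (G := fun s θ => f (nodeTheta s.assign.visited θ s.node))
    fun _ => hf.comp (measurable_pi_apply _)

lemma isHistory_freshWeight (t : ℕ) : IsHistory (𝒜 := 𝒜) t fun x θ => freshWeight x θ t :=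
  isHistory_of_after (G := fun s θ => if s.node ∉ s.visited then
    pathWeight (nodeTheta s.visited θ) [] s.node else 0) fun s => by
      split_ifs
      · exact measurable_const
      · exact (measurable_pathWeight _ _).comp (measurable_nodeTheta _)

end History

/-! ### Integrating out a symbol, and orthogonality of increments -/

section Source

variable {𝒜 : Type*} [Fintype 𝒜] [DecidableEq 𝒜] [MeasurableSpace 𝒜] [MeasurableSingletonClass 𝒜]
  {Pr : Measure (stdSimplex ℝ 𝒜)} [IsProbabilityMeasure Pr]
  {Ω : Type*} [MeasurableSpace Ω] {μ : Measure Ω} [IsProbabilityMeasure μ]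
  {Θ : ℕ → Ω → stdSimplex ℝ 𝒜} {X : ℕ → Ω → 𝒜}

/-- The sequence of the values of a process at a point. -/
abbrev path {E Ω : Type*} (Z : ℕ → Ω → E) (ω : Ω) : ℕ → E := fun i => Z i ω

lemma B_eq (t : ℕ) (ω : Ω) :
    B Θ X t ω = thetaAt (path X ω) (path Θ ω) t (nodeAt (path X ω) t) := rfl

namespace IsSource

lemma nonempty_alphabet (Pr : Measure (stdSimplex ℝ 𝒜)) [IsProbabilityMeasure Pr] : Nonempty 𝒜 := by
  obtain ⟨θ⟩ := nonempty_of_isProbabilityMeasure Pr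
  by_contra h
  rw [not_nonempty_iff] at h
  have := simplex_sum θ
  simp at this

lemma measurable_history (hs : IsSource Pr μ Θ X) {t : ℕ}
    {Ψ : (ℕ → 𝒜) → (ℕ → stdSimplex ℝ 𝒜) → ℝ} (h : IsHistory t Ψ) :
    Measurable fun ω => Ψ (path X ω) (path Θ ω) := by
  have := nonempty_alphabet Pr
  exact h.measurable_comp (fun s _ => hs.measurable_symbol s)
    (measurable_pi_lambda _ hs.measurable_theta)

lemma measurable_history_past (_hs : IsSource Pr μ Θ X) {t : ℕ}
    {Ψ : (ℕ → 𝒜) → (ℕ → stdSimplex ℝ 𝒜) → ℝ} (h : IsHistory t Ψ) :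
    Measurable[past Θ X t] fun ω => Ψ (path X ω) (path Θ ω) := by
  have := nonempty_alphabet Pr
  refine h.measurable_comp (m := past Θ X t) (X := path X) (Θ := path Θ) (fun s hst => ?_) ?_
  · refine Measurable.mono (comap_measurable (X s)) ?_ le_rfl
    exact le_sup_of_le_right (le_iSup (fun s : Fin t => MeasurableSpace.comap (X s) inferInstance)
      ⟨s, hst⟩)
  · refine @measurable_pi_lambda _ _ _ (past Θ X t) _ _ fun i => ?_
    refine Measurable.mono (comap_measurable (Θ i)) ?_ le_rfl
    exact le_sup_of_le_left (le_iSup (fun i => MeasurableSpace.comap (Θ i) inferInstance) i)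

lemma past_le (hs : IsSource Pr μ Θ X) (t : ℕ) : past Θ X t ≤ ‹MeasurableSpace Ω› :=
  sup_le (iSup_le fun i => (hs.measurable_theta i).comap_le)
    (iSup_le fun s => (hs.measurable_symbol s).comap_le)

lemma integrable_history (hs : IsSource Pr μ Θ X) {t : ℕ}
    {Ψ : (ℕ → 𝒜) → (ℕ → stdSimplex ℝ 𝒜) → ℝ} (h : IsHistory t Ψ) {C : ℝ}
    (hC : ∀ x θ, |Ψ x θ| ≤ C) : Integrable (fun ω => Ψ (path X ω) (path Θ ω)) μ :=
  .of_bound (hs.measurable_history h).aestronglyMeasurable C (ae_of_all _ fun _ => hC _ _)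

/-- The symbol at time `t` is drawn from `B t`, conditionally on the past. -/
lemma integral_symbol (hs : IsSource Pr μ Θ X) {t : ℕ}
    {U : 𝒜 → (ℕ → 𝒜) → (ℕ → stdSimplex ℝ 𝒜) → ℝ} (h : ∀ a, IsHistory t (U a)) {C : ℝ}
    (hC : ∀ a x θ, |U a x θ| ≤ C) :
    ∫ ω, U (X t ω) (path X ω) (path Θ ω) ∂μ =
      ∑ a, ∫ ω, B Θ X t ω a * U a (path X ω) (path Θ ω) ∂μ := by
  have hind : ∀ a, Integrable ((X t ⁻¹' {a}).indicator fun _ => (1 : ℝ)) μ := fun a =>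
    (integrable_const _).indicator (hs.measurable_symbol t (measurableSet_singleton a))
  have hint : ∀ a, Integrable (fun ω => U a (path X ω) (path Θ ω)
      * (X t ⁻¹' {a}).indicator (fun _ => (1 : ℝ)) ω) μ := fun a =>
    (hind a).bdd_mul (hs.measurable_history (h a)).aestronglyMeasurable
      (ae_of_all _ fun _ => hC a _ _)
  have h1 : ∀ ω, U (X t ω) (path X ω) (path Θ ω) = ∑ a, U a (path X ω) (path Θ ω)
      * (X t ⁻¹' {a}).indicator (fun _ => (1 : ℝ)) ω := fun ω => by
    rw [Finset.sum_eq_single_of_mem (X t ω) (Finset.mem_univ _) fun b _ hb => by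
      rw [Set.indicator_of_notMem (by exact fun h => hb h.symm), mul_zero],
      Set.indicator_of_mem (by rfl), mul_one]
  rw [integral_congr_ae (ae_of_all _ h1), integral_finsetSum _ fun a _ => hint a]
  refine Finset.sum_congr rfl fun a _ => ?_
  rw [← integral_condExp (hs.past_le t)]
  refine integral_congr_ae ?_
  have h2 := condExp_mul_of_stronglyMeasurable_left (μ := μ) (m := past Θ X t)
    (f := fun ω => U a (path X ω) (path Θ ω)) (g := (X t ⁻¹' {a}).indicator fun _ => (1 : ℝ))
    (hs.measurable_history_past (h a)).stronglyMeasurable (hint a) (hind a)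
  filter_upwards [h2, hs.cond_symbol t a] with ω h3 h4
  refine h3.trans ?_
  rw [Pi.mul_apply, h4, mul_comm]

/-- A sum of increments which have mean zero conditionally on the past has orthogonal
increments. -/
lemma integral_sq_sum (hs : IsSource Pr μ Θ X)
    {d : ℕ → 𝒜 → (ℕ → 𝒜) → (ℕ → stdSimplex ℝ 𝒜) → ℝ} (h : ∀ t a, IsHistory t (d t a))
    {C : ℕ → ℝ} (hC : ∀ t a x θ, |d t a x θ| ≤ C t)
    (h0 : ∀ t x θ, ∑ a, thetaAt x θ t (nodeAt x t) a * d t a x θ = 0) (n : ℕ) :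
    ∫ ω, (∑ t ∈ Finset.range n, d t (X t ω) (path X ω) (path Θ ω)) ^ 2 ∂μ
      = ∑ t ∈ Finset.range n, ∫ ω, d t (X t ω) (path X ω) (path Θ ω) ^ 2 ∂μ := by
  induction n with
  | zero => simp
  | succ n ih =>
    let M : (ℕ → 𝒜) → (ℕ → stdSimplex ℝ 𝒜) → ℝ := fun x θ => ∑ t ∈ Finset.range n, d t (x t) x θ
    have hM : IsHistory n M := IsHistory.sum _ fun t ht =>
      (IsHistory.symbol (h t)).mono (Finset.mem_range.1 ht)
    have hMC : ∀ x θ, |M x θ| ≤ ∑ t ∈ Finset.range n, C t := fun x θ =>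
      (Finset.abs_sum_le_sum_abs _ _).trans (Finset.sum_le_sum fun t _ => hC _ _ _ _)
    have hD := IsHistory.symbol (h n)
    have hb : ∀ (u v : ℝ) {a b : ℝ}, |u| ≤ a → |v| ≤ b → |u * v| ≤ a * b := fun u v a b h1 h2 => by
      rw [abs_mul]; exact mul_le_mul h1 h2 (abs_nonneg _) ((abs_nonneg _).trans h1)
    -- `M` is known before the symbol at time `n` is drawn, so averaging over that symbol leaves `M`
    -- times the vanishing sum in `h0`.
    have hcross : ∫ ω, M (path X ω) (path Θ ω) * d n (X n ω) (path X ω) (path Θ ω) ∂μ = 0 := by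
      have hU : ∀ a, IsHistory n fun x θ => M x θ * d n a x θ := fun a => hM.mul (h n a)
      rw [hs.integral_symbol (U := fun a x θ => M x θ * d n a x θ) hU
        (fun a x θ => hb _ _ (hMC x θ) (hC n a x θ)), ← integral_finsetSum]
      · rw [← integral_zero Ω ℝ]
        congr 1
        funext ω
        simp only [B_eq, mul_left_comm _ (M _ _), ← Finset.mul_sum, h0, mul_zero]
      · intro a _
        refine hs.integrable_history ((isHistory_thetaAt n (measurable_simplex_apply a)).mul (hU a))
          (fun x θ => hb _ _ (a := 1) ?_ (hb _ _ (hMC x θ) (hC n a x θ)))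
        rw [abs_of_nonneg (simplex_nonneg _ _)]; exact simplex_le_one _ _
    have i1 := hs.integrable_history (hM.mul hM) (fun x θ => hb _ _ (hMC x θ) (hMC x θ))
    have i2 : Integrable (fun ω => 2 * (M (path X ω) (path Θ ω)
        * d n (X n ω) (path X ω) (path Θ ω))) μ :=
      (hs.integrable_history ((hM.mono n.le_succ).mul hD)
        (fun x θ => hb _ _ (hMC x θ) (hC n _ x θ))).const_mul 2
    have i3 : Integrable (fun ω => d n (X n ω) (path X ω) (path Θ ω)
        * d n (X n ω) (path X ω) (path Θ ω)) μ :=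
      hs.integrable_history (hD.mul hD) (fun x θ => hb _ _ (hC n _ x θ) (hC n _ x θ))
    have i4 : Integrable (fun ω => M (path X ω) (path Θ ω) * M (path X ω) (path Θ ω)
        + d n (X n ω) (path X ω) (path Θ ω) * d n (X n ω) (path X ω) (path Θ ω)) μ := i1.add i3
    rw [Finset.sum_range_succ _ n, ← ih]
    have h1 : ∀ ω, (∑ t ∈ Finset.range (n + 1), d t (X t ω) (path X ω) (path Θ ω)) ^ 2
        = (M (path X ω) (path Θ ω) * M (path X ω) (path Θ ω)
          + d n (X n ω) (path X ω) (path Θ ω) * d n (X n ω) (path X ω) (path Θ ω))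
          + 2 * (M (path X ω) (path Θ ω) * d n (X n ω) (path X ω) (path Θ ω)) := fun ω => by
      rw [Finset.sum_range_succ]; simp only [M, path]; ring
    rw [integral_congr_ae (ae_of_all _ h1), integral_add i4 i2, integral_add i1 i3,
      integral_const_mul, hcross]
    simp only [M, sq, mul_zero, add_zero]

end IsSource

end Source

/-! ### Almost sure convergence from second moments along fourth powers -/

section Limits

/-- The series of squares has finite integral, hence converges almost surely. -/
lemma ae_tendsto_zero_of_summable {Ω : Type*} [MeasurableSpace Ω] {μ : Measure Ω}
    {Z : ℕ → Ω → ℝ} (hZ : ∀ j, Integrable (fun ω => Z j ω ^ 2) μ)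
    (hsum : Summable fun j => ∫ ω, Z j ω ^ 2 ∂μ) :
    ∀ᵐ ω ∂μ, Tendsto (fun j => Z j ω) atTop (𝓝 0) := by
  have hm : ∀ j, AEMeasurable (fun ω => ENNReal.ofReal (Z j ω ^ 2)) μ := fun j =>
    (hZ j).aemeasurable.ennreal_ofReal
  have h1 : ∫⁻ ω, ∑' j, ENNReal.ofReal (Z j ω ^ 2) ∂μ ≠ ⊤ := by
    rw [lintegral_tsum hm]
    have h2 : ∀ j, ∫⁻ ω, ENNReal.ofReal (Z j ω ^ 2) ∂μ = ENNReal.ofReal (∫ ω, Z j ω ^ 2 ∂μ) :=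
      fun j => (ofReal_integral_eq_lintegral_ofReal (hZ j) (ae_of_all _ fun _ => sq_nonneg _)).symm
    simp_rw [h2]
    exact hsum.tsum_ofReal_ne_top
  filter_upwards [ae_lt_top' (AEMeasurable.tsum hm) h1] with ω hω
  have h3 := ENNReal.tendsto_atTop_zero_of_tsum_ne_top hω.ne
  have h4 := (ENNReal.tendsto_toReal ENNReal.zero_ne_top).comp h3
  have h5 : Tendsto (fun j => Real.sqrt (Z j ω ^ 2)) atTop (𝓝 (Real.sqrt 0)) := by
    refine (Real.continuous_sqrt.tendsto 0).comp ?_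
    simpa [Function.comp_def, ENNReal.toReal_ofReal, sq_nonneg] using h4
  simp only [Real.sqrt_sq_eq_abs, Real.sqrt_zero] at h5
  exact (tendsto_zero_iff_abs_tendsto_zero _).2 h5

lemma tendsto_pow_four_atTop : Tendsto (fun j : ℕ => (j + 1) ^ 4) atTop atTop :=
  (tendsto_pow_atTop (by norm_num)).comp (tendsto_add_atTop_nat 1)

/-- Averages of bounded sequences converge if they converge along the fourth powers. -/
lemma tendsto_div_of_tendsto_pow_four {u : ℕ → ℝ} (hu : ∀ n, |u (n + 1) - u n| ≤ 1)
    (h : Tendsto (fun j : ℕ => u ((j + 1) ^ 4) / ((j + 1) ^ 4 : ℕ)) atTop (𝓝 0)) :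
    Tendsto (fun n : ℕ => u n / n) atTop (𝓝 0) := by
  -- Adding `n` makes the sequence monotone, so that convergence along a subsequence suffices when
  -- ratios of consecutive indices tend to `1`.
  have h1 : Tendsto (fun n : ℕ => (u n + n) / n) atTop (𝓝 1) := by
    refine tendsto_div_of_monotone_of_exists_subseq_tendsto_div (fun n => u n + n) 1
      (monotone_nat_of_le_succ fun n => ?_) fun a ha =>
        ⟨fun j => (j + 1) ^ 4, ?_, tendsto_pow_four_atTop, ?_⟩
    · have := (abs_le.1 (hu n)).1
      push_cast
      linarith
    · have h2 : Tendsto (fun j : ℕ => (1 + 1 / ((j : ℝ) + 1)) ^ 4) atTop (𝓝 ((1 + 0) ^ 4)) :=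
        (tendsto_const_nhds.add tendsto_one_div_add_atTop_nhds_zero_nat).pow 4
      rw [add_zero, one_pow] at h2
      filter_upwards [h2.eventually_lt_const ha] with j hj
      have h3 : (0 : ℝ) < (j : ℝ) + 1 := by positivity
      push_cast
      calc ((j : ℝ) + 1 + 1) ^ 4 = (1 + 1 / ((j : ℝ) + 1)) ^ 4 * (j + 1) ^ 4 := by
            rw [← mul_pow]; congr 1; field_simp
        _ ≤ _ := by gcongr
    · have h2 := h.add (tendsto_const_nhds (x := (1 : ℝ)))
      rw [zero_add] at h2
      refine h2.congr fun j => ?_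
      have h3 : (((j + 1) ^ 4 : ℕ) : ℝ) ≠ 0 := by positivity
      field_simp
  have h2 := h1.sub (tendsto_const_nhds (x := (1 : ℝ)))
  rw [sub_self] at h2
  refine h2.congr' ?_
  filter_upwards [eventually_gt_atTop 0] with n hn
  have : (n : ℝ) ≠ 0 := by positivity
  field_simp
  ring

end Limits

/-! ### Second moments of the deviations -/

section Source

variable {𝒜 : Type*} [Fintype 𝒜] [DecidableEq 𝒜] [MeasurableSpace 𝒜] [MeasurableSingletonClass 𝒜]
  {Pr : Measure (stdSimplex ℝ 𝒜)} [IsProbabilityMeasure Pr]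
  {Ω : Type*} [MeasurableSpace Ω] {μ : Measure Ω} [IsProbabilityMeasure μ]
  {Θ : ℕ → Ω → stdSimplex ℝ 𝒜} {X : ℕ → Ω → 𝒜}
  {F : (List 𝒜 → stdSimplex ℝ 𝒜) → List 𝒜 → ℝ}

lemma summable_of_le_div {C : ℝ} {f : ℕ → ℝ} (h0 : ∀ j, 0 ≤ f j)
    (h : ∀ j, f j ≤ C / ((j : ℝ) + 1) ^ 2) : Summable f := by
  have h1 : Summable fun j : ℕ => 1 / (((j + 1 : ℕ) : ℝ)) ^ 2 :=
    (summable_nat_add_iff 1 (f := fun j : ℕ => 1 / ((j : ℝ)) ^ 2)).2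
      (Real.summable_one_div_nat_pow.2 (by norm_num))
  refine Summable.of_nonneg_of_le h0 h ((h1.mul_left C).congr fun j => ?_)
  push_cast
  ring

lemma remaining_abs_le (hF : IsNodeFunctional F) (x : ℕ → 𝒜) (θ : ℕ → stdSimplex ℝ 𝒜) (t : ℕ)
    (w : List 𝒜) : |remaining F x θ t w| ≤ Nat.sqrt (2 * t) + 1 := by
  rw [abs_of_nonneg (remaining_nonneg _ _ _ _ hF.nonneg)]
  exact remaining_le _ _ _ _ hF.le_one

/-- The expected remaining sum after the current node. -/
lemma remaining_sub_current_nonneg (hF : IsNodeFunctional F) (x : ℕ → 𝒜) (θ : ℕ → stdSimplex ℝ 𝒜)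
    (t : ℕ) : 0 ≤ remaining F x θ t (nodeAt x t) - current F x θ t := by
  rw [← sum_mul_remaining]
  exact Finset.sum_nonneg fun a _ => mul_nonneg (simplex_nonneg _ _)
    (remaining_nonneg _ _ _ _ hF.nonneg)

lemma deviation_abs_le (hF : IsNodeFunctional F) (a : 𝒜) (x : ℕ → 𝒜) (θ : ℕ → stdSimplex ℝ 𝒜)
    (t : ℕ) : |deviation F a x θ t| ≤ Nat.sqrt (2 * t) + 1 := by
  have h1 := remaining_sub_current_nonneg hF x θ t
  have h2 := remaining_nonneg x θ t (nodeAt x t ++ [a]) hF.nonneg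
  have h3 := remaining_le x θ t (nodeAt x t ++ [a]) hF.le_one
  have h4 := remaining_le x θ t (nodeAt x t) hF.le_one
  have h5 : 0 ≤ current F x θ t := hF.nonneg _ _
  rw [deviation, abs_le]
  constructor <;> linarith

namespace IsSource

/-- Variance is second moment minus squared mean, conditionally on the past. -/
lemma integral_sq_deviation (hs : IsSource Pr μ Θ X) (hF : IsNodeFunctional F) (t : ℕ) :
    ∫ ω, deviation F (X t ω) (path X ω) (path Θ ω) t ^ 2 ∂μ
      = ∫ ω, (remaining F (path X ω) (path Θ ω) t (nodeAt (path X ω) t ++ [X t ω]) ^ 2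
        - (remaining F (path X ω) (path Θ ω) t (nodeAt (path X ω) t)
          - current F (path X ω) (path Θ ω) t) ^ 2) ∂μ := by
  let E : (ℕ → 𝒜) → (ℕ → stdSimplex ℝ 𝒜) → ℝ := fun x θ =>
    remaining F x θ t (nodeAt x t) - current F x θ t
  have hE : IsHistory t E := by
    have := hF.isHistory_remaining t []
    simp only [List.append_nil] at this
    exact this.sub (hF.isHistory_current t)
  set S : ℝ := Nat.sqrt (2 * t) + 1
  have hS : 0 ≤ S := by positivity
  have hEC : ∀ x θ, |E x θ| ≤ S := fun x θ => by
    rw [abs_of_nonneg (remaining_sub_current_nonneg hF x θ t)]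
    have h1 := remaining_le x θ t (nodeAt x t) hF.le_one
    have h5 : 0 ≤ current F x θ t := hF.nonneg _ _
    linarith
  have hb : ∀ (u v : ℝ), |u| ≤ S → |v| ≤ S → |u * v| ≤ S * S := fun u v h1 h2 => by
    rw [abs_mul]; exact mul_le_mul h1 h2 (abs_nonneg _) hS
  have hU : ∀ a, IsHistory t fun x θ => E x θ * deviation F a x θ t := fun a =>
    hE.mul (hF.isHistory_deviation t a)
  have hUC : ∀ a x θ, |E x θ * deviation F a x θ t| ≤ S * S := fun a x θ =>
    hb _ _ (hEC x θ) (deviation_abs_le hF a x θ t)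
  have hcross : ∫ ω, E (path X ω) (path Θ ω) * deviation F (X t ω) (path X ω) (path Θ ω) t ∂μ
      = 0 := by
    rw [hs.integral_symbol (U := fun a x θ => E x θ * deviation F a x θ t) hU hUC,
      ← integral_finsetSum]
    · rw [← integral_zero Ω ℝ]
      congr 1
      funext ω
      simp only [B_eq, mul_left_comm _ (E _ _), ← Finset.mul_sum, sum_mul_deviation, mul_zero]
    · intro a _
      refine hs.integrable_history ((isHistory_thetaAt t (measurable_simplex_apply a)).mul (hU a))
        (C := 1 * (S * S)) fun x θ => ?_
      rw [abs_mul, abs_of_nonneg (simplex_nonneg _ _)]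
      exact mul_le_mul (simplex_le_one _ _) (hUC a x θ) (abs_nonneg _) zero_le_one
  have i1 : Integrable (fun ω => 2 * (E (path X ω) (path Θ ω)
      * deviation F (X t ω) (path X ω) (path Θ ω) t)) μ :=
    (hs.integrable_history (IsHistory.symbol hU) fun x θ => hUC _ _ _).const_mul 2
  have i2 : Integrable (fun ω => deviation F (X t ω) (path X ω) (path Θ ω) t ^ 2) μ := by
    simp only [sq]
    exact hs.integrable_history ((IsHistory.symbol (hF.isHistory_deviation t)).mul
      (IsHistory.symbol (hF.isHistory_deviation t)))
      fun x θ => hb _ _ (deviation_abs_le hF _ x θ t) (deviation_abs_le hF _ x θ t)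
  calc _ = ∫ ω, deviation F (X t ω) (path X ω) (path Θ ω) t ^ 2 ∂μ
        + ∫ ω, 2 * (E (path X ω) (path Θ ω)
          * deviation F (X t ω) (path X ω) (path Θ ω) t) ∂μ := by
        rw [integral_const_mul, hcross, mul_zero, add_zero]
    _ = _ := by
        rw [← integral_add i2 i1]
        congr 1
        funext ω
        simp only [E, deviation]
        ring

/-- Single increments can be of order `√n`, and squaring them one by one would give a useless `n ^
2`. In the variance identity, however, the squared potentials telescope, and only a cost of `2 * S`
per step survives. -/
lemma integral_sq_sum_deviation_le (hs : IsSource Pr μ Θ X) (hF : IsNodeFunctional F) (n : ℕ) :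
    ∫ ω, (∑ t ∈ Finset.range n, deviation F (X t ω) (path X ω) (path Θ ω) t) ^ 2 ∂μ
      ≤ ((Nat.sqrt (2 * n) : ℝ) + 1) ^ 2 + 2 * n * (Nat.sqrt (2 * n) + 1) := by
  set S : ℝ := (Nat.sqrt (2 * n) : ℝ) + 1
  rw [hs.integral_sq_sum (d := fun t a x θ => deviation F a x θ t)
    (fun t a => hF.isHistory_deviation t a) (fun t a x θ => deviation_abs_le hF a x θ t)
    (fun t x θ => sum_mul_deviation x θ t)]
  rw [Finset.sum_congr rfl fun t _ => hs.integral_sq_deviation hF t]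
  have hmeas : ∀ t, Integrable (fun ω =>
      (remaining F (path X ω) (path Θ ω) t (nodeAt (path X ω) t ++ [X t ω]) ^ 2
        - (remaining F (path X ω) (path Θ ω) t (nodeAt (path X ω) t)
          - current F (path X ω) (path Θ ω) t) ^ 2)) μ := fun t => by
    have h0 := hF.isHistory_remaining t []
    simp only [List.append_nil] at h0
    have h1 := IsHistory.symbol fun a => hF.isHistory_remaining t [a]
    have h2 := h0.sub (hF.isHistory_current t)
    have h3 := (h1.mul h1).sub ((h2.mul h2).mono t.le_succ)
    simp only [← sq] at h3
    refine hs.integrable_history h3 (C := 2 * ((Nat.sqrt (2 * t) : ℝ) + 1) ^ 2) fun x θ => ?_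
    have h4 := remaining_abs_le hF x θ t (nodeAt x t ++ [x t])
    have h5 := remaining_sub_current_nonneg hF x θ t
    have h6 := remaining_le x θ t (nodeAt x t) hF.le_one
    have h7 : 0 ≤ current F x θ t := hF.nonneg _ _
    have h8 : remaining F x θ t (nodeAt x t ++ [x t]) ^ 2 ≤ ((Nat.sqrt (2 * t) : ℝ) + 1) ^ 2 :=
      sq_le_sq' (abs_le.1 h4).1 (abs_le.1 h4).2
    have h9 : (remaining F x θ t (nodeAt x t) - current F x θ t) ^ 2
        ≤ ((Nat.sqrt (2 * t) : ℝ) + 1) ^ 2 := pow_le_pow_left₀ h5 (by linarith) 2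
    rw [abs_le]
    constructor <;> nlinarith [sq_nonneg (remaining F x θ t (nodeAt x t ++ [x t])),
      sq_nonneg (remaining F x θ t (nodeAt x t) - current F x θ t)]
  rw [← integral_finsetSum _ fun t _ => hmeas t]
  have hle : ∀ ω, ∑ t ∈ Finset.range n,
      (remaining F (path X ω) (path Θ ω) t (nodeAt (path X ω) t ++ [X t ω]) ^ 2
        - (remaining F (path X ω) (path Θ ω) t (nodeAt (path X ω) t)
          - current F (path X ω) (path Θ ω) t) ^ 2) ≤ S ^ 2 + 2 * n * S := by
    intro ω
    let h : ℕ → ℝ := fun t => remaining F (path X ω) (path Θ ω) t (nodeAt (path X ω) t)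
    have hh : ∀ t, 0 ≤ h t := fun t => remaining_nonneg _ _ _ _ hF.nonneg
    have hhS : ∀ t ≤ n, h t ≤ S := fun t ht => by
      refine (remaining_le _ _ _ _ hF.le_one).trans (add_le_add ?_ le_rfl)
      exact_mod_cast Nat.sqrt_le_sqrt (by omega)
    -- Since `current` is in `[0, 1]` and `h t ≤ S`, the squared conditional mean is at least `h t ^
    -- 2 - 2 * S`.
    calc _ ≤ ∑ t ∈ Finset.range n, ((h (t + 1) ^ 2 - h t ^ 2) + 2 * S) := by
          refine Finset.sum_le_sum fun t ht => ?_
          have h1 := sq_remaining_le (path X ω) (path Θ ω) t hF.isLocal hF.nonneg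
          have h2 : 0 ≤ current F (path X ω) (path Θ ω) t := hF.nonneg _ _
          have h3 : current F (path X ω) (path Θ ω) t ≤ 1 := hF.le_one _ _
          have h4 := hhS t (Finset.mem_range.1 ht).le
          have h5 := hh t
          simp only [path] at *
          nlinarith
      _ = h n ^ 2 - h 0 ^ 2 + n * (2 * S) := by
          rw [Finset.sum_add_distrib, Finset.sum_range_sub (fun t => h t ^ 2)]
          simp
      _ ≤ _ := by nlinarith [pow_le_pow_left₀ (hh n) (hhS n le_rfl) 2, sq_nonneg (h 0)]
  calc _ ≤ ∫ _, (S ^ 2 + 2 * n * S) ∂μ :=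
        integral_mono (integrable_finsetSum _ fun t _ => hmeas t) (integrable_const _) hle
    _ = _ := by simp

/-- The normalized second moment is `O(n^(-1/2))`, that is `O((j + 1)^(-2))` for `n = (j + 1) ^ 4`,
which is summable. The unbounded increments prevent `tendsto_div_of_tendsto_pow_four` from being
applied here. -/
lemma ae_tendsto_sum_deviation (hs : IsSource Pr μ Θ X) (hF : IsNodeFunctional F) :
    ∀ᵐ ω ∂μ, Tendsto (fun j : ℕ => (∑ t ∈ Finset.range ((j + 1) ^ 4),
      deviation F (X t ω) (path X ω) (path Θ ω) t) / ((j + 1) ^ 4 : ℕ)) atTop (𝓝 0) := by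
  have hd : ∀ n, IsHistory n fun x θ => ∑ t ∈ Finset.range n, deviation F (x t) x θ t := fun n =>
    IsHistory.sum _ fun t ht =>
      (IsHistory.symbol (hF.isHistory_deviation t)).mono (Finset.mem_range.1 ht)
  refine ae_tendsto_zero_of_summable (fun j => ?_)
    (summable_of_le_div (C := 15) (fun j => integral_nonneg fun ω => sq_nonneg _) fun j => ?_)
  · simp only [div_pow]
    refine Integrable.div_const ?_ _
    simp only [sq]
    refine hs.integrable_history ((hd _).mul (hd _)) (C := (∑ t ∈ Finset.range ((j + 1) ^ 4),
      ((Nat.sqrt (2 * t) : ℝ) + 1)) ^ 2) fun x θ => ?_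
    rw [← sq, abs_of_nonneg (sq_nonneg _)]
    have h1 := (Finset.abs_sum_le_sum_abs (fun t => deviation F (x t) x θ t)
      (Finset.range ((j + 1) ^ 4))).trans
        (Finset.sum_le_sum fun t _ => deviation_abs_le hF (x t) x θ t)
    exact sq_le_sq' (abs_le.1 h1).1 (abs_le.1 h1).2
  · simp only [div_pow, integral_div]
    have h1 := hs.integral_sq_sum_deviation_le hF ((j + 1) ^ 4)
    have h2 : (Nat.sqrt (2 * (j + 1) ^ 4) : ℝ) ≤ 2 * ((j : ℝ) + 1) ^ 2 := by
      have : Nat.sqrt (2 * (j + 1) ^ 4) ≤ 2 * (j + 1) ^ 2 := by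
        rw [← Nat.sqrt_eq (2 * (j + 1) ^ 2)]
        exact Nat.sqrt_le_sqrt (by nlinarith [Nat.zero_le ((j + 1) ^ 4)])
      exact_mod_cast this
    set k : ℝ := (j : ℝ) + 1 with hk
    have hk1 : 1 ≤ k := by rw [hk]; linarith [Nat.cast_nonneg (α := ℝ) j]
    have h0 : (0 : ℝ) ≤ (Nat.sqrt (2 * (j + 1) ^ 4) : ℝ) := Nat.cast_nonneg _
    set s : ℝ := (Nat.sqrt (2 * (j + 1) ^ 4) : ℝ)
    have h3 : (((j + 1) ^ 4 : ℕ) : ℝ) = k ^ 4 := by push_cast; rfl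
    rw [h3] at h1 ⊢
    rw [div_le_div_iff₀ (by positivity) (by positivity)]
    have h4 : s + 1 ≤ 3 * k ^ 2 := by nlinarith
    have h5 : (s + 1) ^ 2 ≤ 9 * k ^ 4 := by
      calc _ ≤ (3 * k ^ 2) ^ 2 := pow_le_pow_left₀ (by linarith) h4 2
        _ = _ := by ring
    -- From `s + 1 ≤ 3 * k ^ 2` the two terms contribute `9` and `6`, whence the `15`.
    have h6 : (s + 1) ^ 2 + 2 * k ^ 4 * (s + 1) ≤ 15 * k ^ 6 := by
      have h7 : k ^ 4 ≤ k ^ 6 := pow_le_pow_right₀ hk1 (by norm_num)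
      have h8 : 2 * k ^ 4 * (s + 1) ≤ 2 * k ^ 4 * (3 * k ^ 2) := by gcongr
      calc _ ≤ 9 * k ^ 6 + 2 * k ^ 4 * (3 * k ^ 2) := by linarith
        _ = _ := by ring
    calc _ ≤ (15 * k ^ 6) * k ^ 2 := mul_le_mul_of_nonneg_right (h1.trans h6) (by positivity)
      _ = _ := by ring

/-- Orthogonal increments bounded by `1` have second moment at most `n`; boundedness also permits
the passage from fourth powers to all `n`. -/
lemma ae_tendsto_sum_div (hs : IsSource Pr μ Θ X)
    {d : ℕ → 𝒜 → (ℕ → 𝒜) → (ℕ → stdSimplex ℝ 𝒜) → ℝ} (h : ∀ t a, IsHistory t (d t a))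
    (hC : ∀ t a x θ, |d t a x θ| ≤ 1)
    (h0 : ∀ t x θ, ∑ a, thetaAt x θ t (nodeAt x t) a * d t a x θ = 0) :
    ∀ᵐ ω ∂μ, Tendsto (fun n : ℕ => (∑ t ∈ Finset.range n,
      d t (X t ω) (path X ω) (path Θ ω)) / n) atTop (𝓝 0) := by
  have hd : ∀ n, IsHistory n fun x θ => ∑ t ∈ Finset.range n, d t (x t) x θ := fun n =>
    IsHistory.sum _ fun t ht => (IsHistory.symbol (h t)).mono (Finset.mem_range.1 ht)
  have key : ∀ᵐ ω ∂μ, Tendsto (fun j : ℕ => (∑ t ∈ Finset.range ((j + 1) ^ 4),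
      d t (X t ω) (path X ω) (path Θ ω)) / ((j + 1) ^ 4 : ℕ)) atTop (𝓝 0) := by
    refine ae_tendsto_zero_of_summable (fun j => ?_)
      (summable_of_le_div (C := 1) (fun j => integral_nonneg fun ω => sq_nonneg _) fun j => ?_)
    · simp only [div_pow]
      refine Integrable.div_const ?_ _
      simp only [sq]
      refine hs.integrable_history ((hd _).mul (hd _)) (C := (((j + 1) ^ 4 : ℕ) : ℝ) ^ 2)
        fun x θ => ?_
      rw [← sq, abs_of_nonneg (sq_nonneg _)]
      have h1 := (Finset.abs_sum_le_sum_abs (fun t => d t (x t) x θ)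
        (Finset.range ((j + 1) ^ 4))).trans (Finset.sum_le_sum fun t _ => hC t (x t) x θ)
      rw [Finset.sum_const, Finset.card_range, nsmul_eq_mul, mul_one] at h1
      exact sq_le_sq' (abs_le.1 h1).1 (abs_le.1 h1).2
    · simp only [div_pow, integral_div]
      rw [hs.integral_sq_sum h (C := fun _ => 1) hC h0]
      have h1 : ∀ t, ∫ ω, d t (X t ω) (path X ω) (path Θ ω) ^ 2 ∂μ ≤ 1 := fun t => by
        calc _ ≤ ∫ _, (1 : ℝ) ∂μ := by
              refine integral_mono_of_nonneg (ae_of_all _ fun _ => sq_nonneg _)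
                (integrable_const _) (ae_of_all _ fun ω => ?_)
              exact (sq_le_one_iff_abs_le_one _).2 (hC _ _ _ _)
          _ = 1 := by simp
      have h2 : ∑ t ∈ Finset.range ((j + 1) ^ 4), ∫ ω, d t (X t ω) (path X ω) (path Θ ω) ^ 2 ∂μ
          ≤ ((j : ℝ) + 1) ^ 4 := by
        refine (Finset.sum_le_sum fun t _ => h1 t).trans (le_of_eq ?_)
        simp
      have hk1 : 1 ≤ (j : ℝ) + 1 := by linarith [Nat.cast_nonneg (α := ℝ) j]
      push_cast
      rw [div_le_div_iff₀ (by positivity) (by positivity)]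
      calc _ ≤ ((j : ℝ) + 1) ^ 4 * ((j : ℝ) + 1) ^ 2 := by gcongr
        _ = ((j : ℝ) + 1) ^ 6 := by ring
        _ ≤ ((j : ℝ) + 1) ^ 8 := pow_le_pow_right₀ hk1 (by norm_num)
        _ = _ := by ring
  filter_upwards [key] with ω hω
  refine tendsto_div_of_tendsto_pow_four (fun n => ?_) hω
  rw [Finset.sum_range_succ, add_sub_cancel_left]
  exact hC _ _ _ _

end IsSource

end Source

/-! ### Summation by parts -/

section Summation

/-- Summation by parts: if `∑ (d s / a (s + 1))` converges, then `∑ d s` is small compared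
with `a`. -/
lemma exists_bound_of_tendsto {a Y : ℕ → ℝ} (ha : Monotone a) (ha0 : ∀ t, 0 ≤ a t) {L : ℝ}
    (hY : Tendsto Y atTop (𝓝 L)) {ε : ℝ} (hε : 0 < ε) :
    ∃ C, ∀ t, |∑ s ∈ Finset.range t, a (s + 1) * (Y (s + 1) - Y s)| ≤ ε * a t + C := by
  obtain ⟨N, hN⟩ := Metric.tendsto_atTop.1 hY (ε / 2) (by positivity)
  have hZ : ∀ t ≥ N, |Y t - L| ≤ ε / 2 := fun t ht => by
    have := hN t ht; rw [Real.dist_eq] at this; exact this.le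
  set D : ℕ → ℝ := fun t => ∑ s ∈ Finset.range t, a (s + 1) * (Y (s + 1) - Y s)
  have hD : ∀ t, D (t + 1) = D t + a (t + 1) * (Y (t + 1) - Y t) := fun t =>
    Finset.sum_range_succ _ t
  -- Inside the absolute value is minus the sum of `(a (s + 1) - a s) * (Y s - L)` over `N ≤ s < t`.
  -- In the final bound the contributions of `a N` cancel, so `C` only has to dominate the initial
  -- values of `|D|`; `a` may stay bounded.
  have key : ∀ t ≥ N, |D t - D N - a t * (Y t - L) + a N * (Y N - L)| ≤ ε / 2 * (a t - a N) := by
    intro t ht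
    induction t, ht using Nat.le_induction with
    | base => simp
    | succ t ht ih =>
      have h1 : D (t + 1) - D N - a (t + 1) * (Y (t + 1) - L) + a N * (Y N - L)
          = (D t - D N - a t * (Y t - L) + a N * (Y N - L)) - (a (t + 1) - a t) * (Y t - L) := by
        rw [hD]; ring
      have h2 : |(a (t + 1) - a t) * (Y t - L)| ≤ (a (t + 1) - a t) * (ε / 2) := by
        have h3 : 0 ≤ a (t + 1) - a t := sub_nonneg.2 (ha t.le_succ)
        rw [abs_mul, abs_of_nonneg h3]
        exact mul_le_mul_of_nonneg_left (hZ t ht) h3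
      rw [h1]
      refine (abs_sub _ _).trans ?_
      linarith
  refine ⟨∑ s ∈ Finset.range (N + 1), |D s|, fun t => ?_⟩
  have hle : ∀ s ≤ N, |D s| ≤ ∑ s ∈ Finset.range (N + 1), |D s| := fun s hs =>
    Finset.single_le_sum (f := fun s => |D s|) (fun _ _ => abs_nonneg _)
      (Finset.mem_range.2 (by omega))
  rcases le_total t N with ht | ht
  · have h1 := hle t ht
    have h2 : 0 ≤ ε * a t := mul_nonneg hε.le (ha0 t)
    linarith
  · have h1 := key t ht
    have h2 : ∀ s ≥ N, |a s * (Y s - L)| ≤ a s * (ε / 2) := fun s hs => by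
      rw [abs_mul, abs_of_nonneg (ha0 s)]
      exact mul_le_mul_of_nonneg_left (hZ s hs) (ha0 s)
    have h3 := abs_le.1 (h2 t ht)
    have h4 := abs_le.1 (h2 N le_rfl)
    have h5 := abs_le.1 (hle N le_rfl)
    have h6 := abs_le.1 h1
    show |D t| ≤ _
    rw [abs_le]
    constructor <;> linarith

end Summation

/-! ### Functions of the past that see only values already in use -/

section Predictable

variable {𝒜 : Type*} [Fintype 𝒜] [DecidableEq 𝒜]

/-- A function of the symbols before time `t` and of the values which are in use before the
node at time `t` is reached. -/
structure IsPredictable (t : ℕ) (Ψ : (ℕ → 𝒜) → (ℕ → stdSimplex ℝ 𝒜) → ℝ) : Prop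
    extends IsHistory t Ψ where
  theta_congr : ∀ x θ θ', (∀ i < (oldNodes x t).length, θ i = θ' i) → Ψ x θ = Ψ x θ'

lemma oldNodes_length_mono (x : ℕ → 𝒜) : Monotone fun t => (oldNodes x t).length :=
  monotone_nat_of_le_succ fun t => by
    rw [oldNodes_succ]; exact (oldNodes_prefix_labelled x t).length_le

namespace IsPredictable

variable {s t : ℕ} {Ψ Φ : (ℕ → 𝒜) → (ℕ → stdSimplex ℝ 𝒜) → ℝ}

lemma mono (h : IsPredictable s Ψ) (hst : s ≤ t) : IsPredictable t Ψ :=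
  ⟨h.toIsHistory.mono hst, fun x θ θ' hθ => h.theta_congr x θ θ' fun i hi =>
    hθ i (hi.trans_le (oldNodes_length_mono x hst))⟩

lemma mul (h : IsPredictable t Ψ) (h' : IsPredictable t Φ) :
    IsPredictable t fun x θ => Ψ x θ * Φ x θ :=
  ⟨h.toIsHistory.mul h'.toIsHistory, fun x θ θ' hθ => by
    rw [h.theta_congr x θ θ' hθ, h'.theta_congr x θ θ' hθ]⟩

lemma sum {ι : Type*} (u : Finset ι) {Ψ : ι → (ℕ → 𝒜) → (ℕ → stdSimplex ℝ 𝒜) → ℝ}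
    (h : ∀ i ∈ u, IsPredictable t (Ψ i)) : IsPredictable t fun x θ => ∑ i ∈ u, Ψ i x θ :=
  ⟨IsHistory.sum u fun i hi => (h i hi).toIsHistory, fun x θ θ' hθ =>
    Finset.sum_congr rfl fun i hi => (h i hi).theta_congr x θ θ' hθ⟩

lemma comp (h : IsPredictable t Ψ) {f : ℝ → ℝ} (hf : Measurable f) :
    IsPredictable t fun x θ => f (Ψ x θ) :=
  ⟨⟨fun x => hf.comp (h.measurable x), fun x y hxy => by simp only [h.congr x y hxy]⟩,
    fun x θ θ' hθ => by rw [h.theta_congr x θ θ' hθ]⟩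

end IsPredictable

lemma nodeTheta_congr {V : List (List 𝒜)} {θ θ' : ℕ → stdSimplex ℝ 𝒜}
    (h : ∀ i < V.length, θ i = θ' i) {v : List 𝒜} (hv : v ∈ V) :
    nodeTheta V θ v = nodeTheta V θ' v :=
  h _ (List.idxOf_lt_length_of_mem hv)

lemma isPredictable_freshWeight (t : ℕ) :
    IsPredictable (𝒜 := 𝒜) t fun x θ => freshWeight x θ t :=
  ⟨isHistory_freshWeight t, fun x θ θ' hθ => by
    unfold freshWeight
    split_ifs
    · refine pathWeight_congr fun l₁ l₂ h1 h2 => nodeTheta_congr hθ ?_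
      exact mem_oldNodes_of_append x t h1 h2
    · rfl⟩

/-- A function of a node that depends only on the values at the strict ancestors of this node. -/
def IsStrictlyLocal (F : (List 𝒜 → stdSimplex ℝ 𝒜) → List 𝒜 → ℝ) : Prop :=
  ∀ ϑ ϑ' w, (∀ v l, l ≠ [] → v ++ l = w → ϑ v = ϑ' v) → F ϑ w = F ϑ' w

lemma IsNodeFunctional.isPredictable_current {γ : (List 𝒜 → stdSimplex ℝ 𝒜) → List 𝒜 → ℝ}
    (hγ : IsNodeFunctional γ) (hγ' : IsStrictlyLocal γ) (t : ℕ) :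
    IsPredictable t fun x θ => current γ x θ t :=
  ⟨hγ.isHistory_current t, fun x θ θ' hθ => hγ' _ _ _ fun v l hl hv => by
    rw [thetaAt_of_strict x θ t hl hv, thetaAt_of_strict x θ' t hl hv]
    exact nodeTheta_congr hθ (mem_oldNodes_of_append x t hl hv)⟩

/-- The index is `t + 1` because the value at the current node may be assigned only at time `t`. -/
lemma isPredictable_thetaAt (t : ℕ) {f : stdSimplex ℝ 𝒜 → ℝ} (hf : Measurable f) :
    IsPredictable (t + 1) fun x θ => f (thetaAt x θ t (nodeAt x t)) :=
  ⟨(isHistory_thetaAt t hf).mono t.le_succ, fun x θ θ' hθ => by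
    rw [oldNodes_succ] at hθ
    rw [thetaAt, nodeTheta_congr hθ (nodeAt_mem_labelled x t)]; rfl⟩

lemma thetaAt_of_fresh {x : ℕ → 𝒜} {t : ℕ} (h : IsFresh x t) (θ : ℕ → stdSimplex ℝ 𝒜) :
    thetaAt x θ t (nodeAt x t) = θ (oldNodes x t).length := by
  rw [thetaAt, labelled_of_fresh x t h, nodeTheta, List.idxOf_append_of_notMem h]
  simp

end Predictable

/-! ### Independence of the unused values -/

section Source

variable {𝒜 : Type*} [Fintype 𝒜] [DecidableEq 𝒜] [MeasurableSpace 𝒜] [MeasurableSingletonClass 𝒜]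
  {Pr : Measure (stdSimplex ℝ 𝒜)} [IsProbabilityMeasure Pr]
  {Ω : Type*} [MeasurableSpace Ω] {μ : Measure Ω} [IsProbabilityMeasure μ]
  {Θ : ℕ → Ω → stdSimplex ℝ 𝒜} {X : ℕ → Ω → 𝒜}
  {γ : (List 𝒜 → stdSimplex ℝ 𝒜) → List 𝒜 → ℝ} {g : stdSimplex ℝ 𝒜 → ℝ}

namespace IsSource

lemma integral_mul_theta (hs : IsSource Pr μ Θ X) {ψ : (ℕ → stdSimplex ℝ 𝒜) → ℝ}
    (hψ : Measurable ψ) {m : ℕ} (hψm : ∀ θ θ', (∀ i < m, θ i = θ' i) → ψ θ = ψ θ')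
    (hg : Measurable g) (hg0 : ∫ θ, g θ ∂Pr = 0) :
    ∫ ω, ψ (path Θ ω) * g (Θ m ω) ∂μ = 0 := by
  obtain ⟨θ₀⟩ := nonempty_of_isProbabilityMeasure Pr
  have hind := hs.indep_theta.indepFun_finset (Finset.range m) {m} (by simp) hs.measurable_theta
  let e : (Finset.range m → stdSimplex ℝ 𝒜) → ℕ → stdSimplex ℝ 𝒜 := fun y i =>
    if hi : i ∈ Finset.range m then y ⟨i, hi⟩ else θ₀
  have he : Measurable e := measurable_pi_lambda _ fun i => by
    by_cases hi : i ∈ Finset.range m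
    · simp only [e, hi, dite_true]; exact measurable_pi_apply _
    · simp only [e, hi, dite_false]; exact measurable_const
  have h1 : ∀ ω, ψ (path Θ ω) = (ψ ∘ e) fun i : Finset.range m => Θ i ω := fun ω =>
    hψm _ _ fun i hi => by simp [e, hi]
  have h2 := (hind.comp (hψ.comp he) (ψ := fun y : ({m} : Finset ℕ) → stdSimplex ℝ 𝒜 =>
    g (y ⟨m, by simp⟩)) (hg.comp (measurable_pi_apply _))).integral_fun_mul_eq_mul_integral
    ((hψ.comp he).comp (measurable_pi_lambda _ fun i =>
      hs.measurable_theta _)).aestronglyMeasurable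
    (hg.comp (hs.measurable_theta m)).aestronglyMeasurable
  have h3 : ∫ ω, g (Θ m ω) ∂μ = 0 := by
    rw [← hg0, ← hs.law_theta m, integral_map (hs.measurable_theta m).aemeasurable
      hg.aestronglyMeasurable]
  simp only [h1]
  refine h2.trans ?_
  simp only [Function.comp_def]
  rw [h3, mul_zero]

/-- A value which is not in use at time `t` is independent of the symbols before time `t` and of
the values which are in use at this time. -/
lemma integral_mul_unused (hs : IsSource Pr μ Θ X) (hg : Measurable g) (hg1 : ∀ θ, |g θ| ≤ 1)
    (hg0 : ∫ θ, g θ ∂Pr = 0) {t : ℕ} {Ψ : (ℕ → 𝒜) → (ℕ → stdSimplex ℝ 𝒜) → ℝ}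
    (hΨ : IsHistory t Ψ) {C : ℝ} (hC : ∀ x θ, |Ψ x θ| ≤ C) {m : (ℕ → 𝒜) → ℕ}
    (hm : ∀ x y, (∀ s < t, x s = y s) → m x = m y) (hm' : ∀ x, (oldNodes x t).length ≤ m x)
    (hΨm : ∀ x θ θ', (∀ i < m x, θ i = θ' i) → Ψ x θ = Ψ x θ') :
    ∫ ω, Ψ (path X ω) (path Θ ω) * g (Θ (m (path X ω)) ω) ∂μ = 0 := by
  have hb : ∀ (u v : ℝ) {C : ℝ}, |u| ≤ C → |v| ≤ 1 → |u * v| ≤ C := fun u v C h1 h2 => by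
    rw [abs_mul]
    exact (mul_le_of_le_one_right (abs_nonneg u) h2).trans h1
  -- The symbols are integrated out from the last to the first, until only i.i.d. values remain.
  -- Freezing a symbol keeps `m` fixed while `t` decreases, so `m` must be allowed to exceed the
  -- number of values in use.
  induction t generalizing Ψ m with
  | zero =>
    obtain ⟨ω₀⟩ := nonempty_of_isProbabilityMeasure μ
    have h1 : ∀ ω, Ψ (path X ω) (path Θ ω) * g (Θ (m (path X ω)) ω)
        = Ψ (path X ω₀) (path Θ ω) * g (Θ (m (path X ω₀)) ω) := fun ω => by
      rw [hΨ.congr _ (path X ω₀) (by simp), hm _ (path X ω₀) (by simp)]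
    simp only [h1]
    exact hs.integral_mul_theta (hΨ.measurable _) (hΨm _) hg hg0
  | succ t ih =>
    let U : 𝒜 → (ℕ → 𝒜) → (ℕ → stdSimplex ℝ 𝒜) → ℝ := fun a x θ =>
      Ψ (Function.update x t a) θ * g (θ (m (Function.update x t a)))
    have hG : IsHistory (t + 1) fun x θ => Ψ x θ * g (θ (m x)) :=
      hΨ.mul ⟨fun x => hg.comp (measurable_pi_apply _), fun x y hxy => by
        funext θ; rw [hm x y hxy]⟩
    have hU : ∀ a, IsHistory t (U a) := fun a => hG.update a
    have h1 : ∀ ω, Ψ (path X ω) (path Θ ω) * g (Θ (m (path X ω)) ω)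
        = U (X t ω) (path X ω) (path Θ ω) := fun ω => by
      have : Function.update (path X ω) t (X t ω) = path X ω := Function.update_eq_self t _
      simp only [U, this]
    rw [integral_congr_ae (ae_of_all _ h1), hs.integral_symbol hU (C := C)
      (fun a x θ => hb _ _ (hC _ _) (hg1 _))]
    refine Finset.sum_eq_zero fun a _ => ?_
    have h2 := ih (Ψ := fun x θ => thetaAt x θ t (nodeAt x t) a * Ψ (Function.update x t a) θ)
      (m := fun x => m (Function.update x t a))
      ((isHistory_thetaAt t (measurable_simplex_apply a)).mul (hΨ.update a))
      (fun x θ => by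
        rw [mul_comm]
        refine hb _ _ (hC _ _) ?_
        rw [abs_of_nonneg (simplex_nonneg _ _)]
        exact simplex_le_one _ _)
      (fun x y hxy => hm _ _ fun s hst => by
        rcases eq_or_ne s t with rfl | hne
        · simp
        · rw [Function.update_of_ne hne, Function.update_of_ne hne]; exact hxy s (by omega))
      (fun x => ?_) (fun x θ θ' hθ => ?_)
    · refine Eq.trans ?_ h2
      congr 1
      funext ω
      simp only [U, B_eq, mul_assoc]
    · have h3 : oldNodes (Function.update x t a) t = oldNodes x t := by
        unfold oldNodes
        rw [TreeState.after_congr fun s hst => Function.update_of_ne (by omega) a x]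
      rw [← h3]
      exact (oldNodes_length_mono _ t.le_succ).trans (hm' _)
    · have h3 : labelled (Function.update x t a) t = labelled x t := by
        unfold labelled
        rw [TreeState.after_congr fun s hst => Function.update_of_ne (by omega) a x]
      -- The factor from integrating out the symbol is a coordinate of the value at the current
      -- node, which is in use by time `t + 1` and so has index below `m`.
      have h4 : (labelled x t).length ≤ m (Function.update x t a) := by
        rw [← h3, ← oldNodes_succ]; exact hm' _
      show thetaAt x θ t (nodeAt x t) a * _ = thetaAt x θ' t (nodeAt x t) a * _
      rw [hΨm _ θ θ' hθ, thetaAt, thetaAt,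
        nodeTheta_congr (fun i hi => hθ i (hi.trans_le h4)) (nodeAt_mem_labelled x t)]

end IsSource

end Source

/-! ### Truncation, which generates the filtration of used values -/

section Filtration

variable {𝒜 : Type*} [Fintype 𝒜] [DecidableEq 𝒜]

/-- Forget the symbols from time `t` on, and the values which are not in use before the node at
time `t` is reached. -/
def truncate (a₀ : 𝒜) (θ₀ : stdSimplex ℝ 𝒜) (t : ℕ)
    (p : (ℕ → 𝒜) × (ℕ → stdSimplex ℝ 𝒜)) : (ℕ → 𝒜) × (ℕ → stdSimplex ℝ 𝒜) :=
  (fun s => if s < t then p.1 s else a₀, fun i => if i < (oldNodes p.1 t).length then p.2 i else θ₀)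

variable {a₀ : 𝒜} {θ₀ : stdSimplex ℝ 𝒜}

lemma oldNodes_congr {x y : ℕ → 𝒜} {t : ℕ} (h : ∀ s < t, x s = y s) :
    oldNodes x t = oldNodes y t := by
  unfold oldNodes; rw [TreeState.after_congr h]

lemma truncate_truncate {s t : ℕ} (hst : s ≤ t) (p : (ℕ → 𝒜) × (ℕ → stdSimplex ℝ 𝒜)) :
    truncate a₀ θ₀ s (truncate a₀ θ₀ t p) = truncate a₀ θ₀ s p := by
  have h1 : oldNodes (truncate a₀ θ₀ t p).1 s = oldNodes p.1 s :=
    oldNodes_congr fun i hi => if_pos (by omega)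
  refine Prod.ext (funext fun i => ?_) (funext fun i => ?_)
  · simp only [truncate]
    split_ifs <;> first | rfl | omega
  · show (if i < (oldNodes (truncate a₀ θ₀ t p).1 s).length then _ else _) = _
    rw [h1]
    by_cases hi : i < (oldNodes p.1 s).length
    · have := hi.trans_le (oldNodes_length_mono p.1 hst)
      simp only [truncate, hi, this, if_true]
    · simp only [truncate, hi, if_false]

/-- Predictable functions factor through `truncate`; this gives adaptedness to `usedFiltration`. -/
lemma IsPredictable.apply_truncate {t : ℕ} {Ψ : (ℕ → 𝒜) → (ℕ → stdSimplex ℝ 𝒜) → ℝ}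
    (h : IsPredictable t Ψ) (p : (ℕ → 𝒜) × (ℕ → stdSimplex ℝ 𝒜)) :
    Ψ (truncate a₀ θ₀ t p).1 (truncate a₀ θ₀ t p).2 = Ψ p.1 p.2 := by
  rw [h.congr (truncate a₀ θ₀ t p).1 p.1 fun s hs => if_pos hs]
  exact h.theta_congr _ _ _ fun i hi => if_pos hi

variable [MeasurableSpace 𝒜] [MeasurableSingletonClass 𝒜]

lemma IsHistory.measurable_uncurry [Nonempty 𝒜] {t : ℕ}
    {Ψ : (ℕ → 𝒜) → (ℕ → stdSimplex ℝ 𝒜) → ℝ} (h : IsHistory t Ψ) :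
    Measurable fun p : (ℕ → 𝒜) × (ℕ → stdSimplex ℝ 𝒜) => Ψ p.1 p.2 :=
  h.measurable_comp (fun s _ => (measurable_pi_apply s).comp measurable_fst) measurable_snd

lemma measurable_truncate (t : ℕ) : Measurable (truncate a₀ θ₀ t) := by
  have : Nonempty 𝒜 := ⟨a₀⟩
  refine Measurable.prodMk (measurable_pi_lambda _ fun s => ?_) (measurable_pi_lambda _ fun i => ?_)
  · split_ifs
    · exact (measurable_pi_apply s).comp measurable_fst
    · exact measurable_const
  · refine Measurable.ite ?_ ((measurable_pi_apply i).comp measurable_snd) measurable_const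
    have h1 : IsHistory (𝒜 := 𝒜) t fun x _ => ((oldNodes x t).length : ℝ) :=
      ⟨fun _ => measurable_const, fun x y hxy => by rw [oldNodes_congr hxy]⟩
    have h2 := measurableSet_lt (measurable_const (a := (i : ℝ))) h1.measurable_uncurry
    simpa using h2

end Filtration

/-! ### The normalized martingale of node values -/

section Source

variable {𝒜 : Type*} [Fintype 𝒜] [DecidableEq 𝒜] [MeasurableSpace 𝒜] [MeasurableSingletonClass 𝒜]
  {Pr : Measure (stdSimplex ℝ 𝒜)} [IsProbabilityMeasure Pr]
  {Ω : Type*} [MeasurableSpace Ω] {μ : Measure Ω} [IsProbabilityMeasure μ]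
  {Θ : ℕ → Ω → stdSimplex ℝ 𝒜} {X : ℕ → Ω → 𝒜}
  {γ : (List 𝒜 → stdSimplex ℝ 𝒜) → List 𝒜 → ℝ} {g : stdSimplex ℝ 𝒜 → ℝ}

/-- The total weight of the nodes which are in use before the node at time `t` is reached. -/
noncomputable def totalWeight (x : ℕ → 𝒜) (θ : ℕ → stdSimplex ℝ 𝒜) (t : ℕ) : ℝ :=
  ∑ s ∈ Finset.range t, freshWeight x θ s

lemma freshWeight_nonneg (x : ℕ → 𝒜) (θ : ℕ → stdSimplex ℝ 𝒜) (t : ℕ) :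
    0 ≤ freshWeight x θ t := by
  unfold freshWeight; split_ifs
  · exact pathWeight_nonneg _ _ _
  · rfl

lemma freshWeight_le_one (x : ℕ → 𝒜) (θ : ℕ → stdSimplex ℝ 𝒜) (t : ℕ) :
    freshWeight x θ t ≤ 1 := by
  unfold freshWeight; split_ifs
  · exact pathWeight_le_one _ _ _
  · exact zero_le_one

lemma totalWeight_nonneg (x : ℕ → 𝒜) (θ : ℕ → stdSimplex ℝ 𝒜) (t : ℕ) :
    0 ≤ totalWeight x θ t :=
  Finset.sum_nonneg fun _ _ => freshWeight_nonneg _ _ _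

lemma totalWeight_succ (x : ℕ → 𝒜) (θ : ℕ → stdSimplex ℝ 𝒜) (t : ℕ) :
    totalWeight x θ (t + 1) = totalWeight x θ t + freshWeight x θ t :=
  Finset.sum_range_succ _ _

/-- The weight of the node at time `t` involves only its strict ancestors, so the normalization may
include it. -/
lemma isPredictable_totalWeight (t : ℕ) :
    IsPredictable (𝒜 := 𝒜) t fun x θ => totalWeight x θ (t + 1) :=
  IsPredictable.sum _ fun s hs => (isPredictable_freshWeight s).mono
    (Nat.lt_succ_iff.1 (Finset.mem_range.1 hs))

/-- The normalized weight of the node at time `t`. -/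
noncomputable def relativeWeight (γ : (List 𝒜 → stdSimplex ℝ 𝒜) → List 𝒜 → ℝ) (t : ℕ)
    (x : ℕ → 𝒜) (θ : ℕ → stdSimplex ℝ 𝒜) : ℝ :=
  freshWeight x θ t * current γ x θ t * (1 + totalWeight x θ (t + 1))⁻¹

/-- The normalized sum of `γ * g` over the nodes in use. -/
noncomputable def relativeSum (γ : (List 𝒜 → stdSimplex ℝ 𝒜) → List 𝒜 → ℝ)
    (g : stdSimplex ℝ 𝒜 → ℝ) (t : ℕ) (x : ℕ → 𝒜) (θ : ℕ → stdSimplex ℝ 𝒜) : ℝ :=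
  ∑ s ∈ Finset.range t, relativeWeight γ s x θ * g (thetaAt x θ s (nodeAt x s))

/-- A fresh node takes the first unused value; at other times the weight vanishes, so the argument
of `g` may be replaced by that value throughout. -/
lemma relativeSum_succ (t : ℕ) (x : ℕ → 𝒜) (θ : ℕ → stdSimplex ℝ 𝒜) :
    relativeSum γ g (t + 1) x θ
      = relativeSum γ g t x θ + relativeWeight γ t x θ * g (θ (oldNodes x t).length) := by
  rw [relativeSum, Finset.sum_range_succ]
  congr 1
  by_cases h : IsFresh x t
  · rw [thetaAt_of_fresh h]
  · simp [relativeWeight, freshWeight, h]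

lemma isPredictable_relativeWeight (hγ : IsNodeFunctional γ) (hγ' : IsStrictlyLocal γ) (t : ℕ) :
    IsPredictable t (relativeWeight γ t) :=
  ((isPredictable_freshWeight t).mul (hγ.isPredictable_current hγ' t)).mul
    ((isPredictable_totalWeight t).comp (f := fun h => (1 + h)⁻¹) (by fun_prop))

lemma isPredictable_relativeSum (hγ : IsNodeFunctional γ) (hγ' : IsStrictlyLocal γ)
    (hg : Measurable g) (t : ℕ) : IsPredictable t (relativeSum γ g t) :=
  IsPredictable.sum _ fun s hs =>
    (((isPredictable_relativeWeight hγ hγ' s).mono s.le_succ).mul (isPredictable_thetaAt s hg)).mono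
      (Finset.mem_range.1 hs)

lemma relativeWeight_nonneg (hγ : IsNodeFunctional γ) (t : ℕ) (x : ℕ → 𝒜)
    (θ : ℕ → stdSimplex ℝ 𝒜) : 0 ≤ relativeWeight γ t x θ :=
  mul_nonneg (mul_nonneg (freshWeight_nonneg _ _ _) (hγ.nonneg _ _))
    (inv_nonneg.2 (add_nonneg zero_le_one (totalWeight_nonneg _ _ _)))

lemma relativeWeight_le_one (hγ : IsNodeFunctional γ) (t : ℕ) (x : ℕ → 𝒜)
    (θ : ℕ → stdSimplex ℝ 𝒜) : relativeWeight γ t x θ ≤ 1 :=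
  mul_le_one₀ (mul_le_one₀ (freshWeight_le_one _ _ _) (hγ.nonneg _ _) (hγ.le_one _ _))
    (inv_nonneg.2 (add_nonneg zero_le_one (totalWeight_nonneg _ _ _)))
    (inv_le_one_of_one_le₀ (by linarith [totalWeight_nonneg x θ (t + 1)]))

/-- With weight `p` and total weight `H` before it, `p ^ 2 ≤ p` and `p / (1 + H + p) ^ 2 ≤ p / ((1 +
H) * (1 + H + p))`, which telescopes. -/
lemma sq_relativeWeight_le (hγ : IsNodeFunctional γ) (t : ℕ) (x : ℕ → 𝒜)
    (θ : ℕ → stdSimplex ℝ 𝒜) : relativeWeight γ t x θ ^ 2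
      ≤ (1 + totalWeight x θ t)⁻¹ - (1 + totalWeight x θ (t + 1))⁻¹ := by
  have h1 := totalWeight_nonneg x θ t
  have h2 := freshWeight_nonneg x θ t
  have h3 := freshWeight_le_one x θ t
  have h4 : 0 ≤ current γ x θ t := hγ.nonneg _ _
  have h5 : current γ x θ t ≤ 1 := hγ.le_one _ _
  rw [relativeWeight, totalWeight_succ]
  set H := totalWeight x θ t
  set p := freshWeight x θ t
  set c := current γ x θ t
  have h6 : (p * c) ^ 2 ≤ p := by
    have : p * c ≤ p := mul_le_of_le_one_right h2 h5
    have : 0 ≤ p * c := mul_nonneg h2 h4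
    nlinarith
  rw [mul_pow, inv_sub_inv (by positivity) (by positivity), inv_pow, ← div_eq_mul_inv,
    div_le_div_iff₀ (by positivity) (by positivity)]
  have h7 : (1 + (H + p) - (1 + H)) = p := by ring
  rw [h7]
  calc (p * c) ^ 2 * ((1 + H) * (1 + (H + p))) ≤ p * ((1 + H) * (1 + (H + p))) := by gcongr
    _ ≤ p * ((1 + (H + p)) * (1 + (H + p))) := by gcongr; linarith
    _ = _ := by ring

lemma relativeSum_abs_le (hγ : IsNodeFunctional γ) (hg1 : ∀ θ, |g θ| ≤ 1) (t : ℕ) (x : ℕ → 𝒜)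
    (θ : ℕ → stdSimplex ℝ 𝒜) : |relativeSum γ g t x θ| ≤ t := by
  refine (Finset.abs_sum_le_sum_abs _ _).trans ((Finset.sum_le_sum (g := fun _ => 1)
    fun s _ => ?_).trans (by simp))
  rw [abs_mul, abs_of_nonneg (relativeWeight_nonneg hγ _ _ _)]
  exact mul_le_one₀ (relativeWeight_le_one hγ _ _ _) (abs_nonneg _) (hg1 _)

namespace IsSource

/-- The events that depend on the symbols before time `t` and on the values which are in use
before the node at time `t` is reached. -/
def usedFiltration (hs : IsSource Pr μ Θ X) (a₀ : 𝒜) (θ₀ : stdSimplex ℝ 𝒜) :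
    Filtration ℕ ‹MeasurableSpace Ω› where
  seq t := MeasurableSpace.comap (fun ω => truncate a₀ θ₀ t (path X ω, path Θ ω)) inferInstance
  mono' s t hst := by
    have h : (fun ω => truncate a₀ θ₀ s (path X ω, path Θ ω))
        = truncate a₀ θ₀ s ∘ fun ω => truncate a₀ θ₀ t (path X ω, path Θ ω) := by
      funext ω; exact (truncate_truncate hst _).symm
    show MeasurableSpace.comap _ _ ≤ MeasurableSpace.comap _ _
    rw [h, ← MeasurableSpace.comap_comp]
    exact MeasurableSpace.comap_mono (measurable_truncate s).comap_le
  le' t := ((measurable_truncate t).comp ((measurable_pi_lambda _ hs.measurable_symbol).prodMk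
    (measurable_pi_lambda _ hs.measurable_theta))).comap_le

lemma integral_mul_increment (hs : IsSource Pr μ Θ X) (hγ : IsNodeFunctional γ)
    (hγ' : IsStrictlyLocal γ) (hg : Measurable g) (hg1 : ∀ θ, |g θ| ≤ 1)
    (hg0 : ∫ θ, g θ ∂Pr = 0) {t : ℕ} {Ψ : (ℕ → 𝒜) → (ℕ → stdSimplex ℝ 𝒜) → ℝ}
    (hΨ : IsPredictable t Ψ) {C : ℝ} (hC : ∀ x θ, |Ψ x θ| ≤ C) :
    ∫ ω, Ψ (path X ω) (path Θ ω) * (relativeWeight γ t (path X ω) (path Θ ω)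
      * g (Θ (oldNodes (path X ω) t).length ω)) ∂μ = 0 := by
  have h1 := hΨ.mul (isPredictable_relativeWeight hγ hγ' t)
  have h2 := hs.integral_mul_unused hg hg1 hg0 h1.toIsHistory (C := C) (fun x θ => by
      rw [abs_mul, abs_of_nonneg (relativeWeight_nonneg hγ _ _ _)]
      exact (mul_le_of_le_one_right (abs_nonneg _) (relativeWeight_le_one hγ _ _ _)).trans
        (hC x θ)) (m := fun x => (oldNodes x t).length)
    (fun x y hxy => by rw [oldNodes_congr hxy]) (fun _ => le_rfl) h1.theta_congr
  simp only [mul_assoc] at h2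
  exact h2

lemma integrable_relativeSum (hs : IsSource Pr μ Θ X) (hγ : IsNodeFunctional γ)
    (hγ' : IsStrictlyLocal γ) (hg : Measurable g) (hg1 : ∀ θ, |g θ| ≤ 1) (t : ℕ) :
    Integrable (fun ω => relativeSum γ g t (path X ω) (path Θ ω)) μ :=
  hs.integrable_history (isPredictable_relativeSum hγ hγ' hg t).toIsHistory
    (relativeSum_abs_le hγ hg1 t)

lemma integrable_sq_relativeSum (hs : IsSource Pr μ Θ X) (hγ : IsNodeFunctional γ)
    (hγ' : IsStrictlyLocal γ) (hg : Measurable g) (hg1 : ∀ θ, |g θ| ≤ 1) (t : ℕ) :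
    Integrable (fun ω => relativeSum γ g t (path X ω) (path Θ ω) ^ 2) μ := by
  have h := (isPredictable_relativeSum hγ hγ' hg t).toIsHistory
  simp only [sq]
  refine hs.integrable_history (h.mul h) (C := t * t) fun x θ => ?_
  rw [abs_mul]
  exact mul_le_mul (relativeSum_abs_le hγ hg1 t x θ) (relativeSum_abs_le hγ hg1 t x θ)
    (abs_nonneg _) (Nat.cast_nonneg t)

lemma martingale_relativeSum (hs : IsSource Pr μ Θ X) (hγ : IsNodeFunctional γ)
    (hγ' : IsStrictlyLocal γ) (hg : Measurable g) (hg1 : ∀ θ, |g θ| ≤ 1)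
    (hg0 : ∫ θ, g θ ∂Pr = 0) (a₀ : 𝒜) (θ₀ : stdSimplex ℝ 𝒜) :
    Martingale (fun t ω => relativeSum γ g t (path X ω) (path Θ ω))
      (hs.usedFiltration a₀ θ₀) μ := by
  have : Nonempty 𝒜 := ⟨a₀⟩
  have hint := hs.integrable_relativeSum hγ hγ' hg hg1
  refine martingale_of_setIntegral_eq_succ (fun t => ?_) hint fun t E hE => ?_
  · have h := isPredictable_relativeSum hγ hγ' hg t
    refine Measurable.stronglyMeasurable ?_
    have h1 : (fun ω => relativeSum γ g t (path X ω) (path Θ ω))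
        = (fun p : (ℕ → 𝒜) × (ℕ → stdSimplex ℝ 𝒜) => relativeSum γ g t p.1 p.2)
          ∘ fun ω => truncate a₀ θ₀ t (path X ω, path Θ ω) := by
      funext ω; exact (h.apply_truncate (path X ω, path Θ ω)).symm
    rw [h1]
    exact h.toIsHistory.measurable_uncurry.comp (comap_measurable _)
  · have hE' : MeasurableSet E := (hs.usedFiltration a₀ θ₀).le t _ hE
    obtain ⟨E', hE1, rfl⟩ := hE
    -- The indicator of an event of the filtration is a predictable function, hence orthogonal to
    -- the increment.
    let Ψ : (ℕ → 𝒜) → (ℕ → stdSimplex ℝ 𝒜) → ℝ := fun x θ =>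
      E'.indicator (fun _ => 1) (truncate a₀ θ₀ t (x, θ))
    have hΨ : IsPredictable t Ψ := by
      refine ⟨⟨fun x => ?_, fun x y hxy => funext fun θ => ?_⟩, fun x θ θ' hθ => ?_⟩
      · exact (measurable_const.indicator hE1).comp
          ((measurable_truncate t).comp measurable_prodMk_left)
      · have : truncate a₀ θ₀ t (x, θ) = truncate a₀ θ₀ t (y, θ) := by
          simp only [truncate, oldNodes_congr hxy]
          congr 1
          funext s
          split_ifs with hst
          · exact hxy s hst
          · rfl
        simp only [Ψ, this]
      · have : truncate a₀ θ₀ t (x, θ) = truncate a₀ θ₀ t (x, θ') := by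
          simp only [truncate]
          congr 1
          funext i
          split_ifs with hi
          · exact hθ i hi
          · rfl
        simp only [Ψ, this]
    have h1 := hs.integral_mul_increment hγ hγ' hg hg1 hg0 hΨ (C := 1) fun x θ => by
      classical
      simp only [Ψ, Set.indicator_apply]; split_ifs <;> simp
    have h2 : ∀ ω, relativeSum γ g (t + 1) (path X ω) (path Θ ω)
        - relativeSum γ g t (path X ω) (path Θ ω) = relativeWeight γ t (path X ω) (path Θ ω)
          * g (Θ (oldNodes (path X ω) t).length ω) := fun ω => by
      rw [relativeSum_succ, add_sub_cancel_left]
    rw [eq_comm, ← sub_eq_zero, ← integral_sub (hint _).integrableOn (hint _).integrableOn,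
      ← integral_indicator hE', ← h1]
    congr 1
    funext ω
    classical
    simp only [Ψ, Set.indicator_apply, Set.mem_preimage, h2]
    split_ifs <;> simp

lemma integral_sq_relativeSum_le (hs : IsSource Pr μ Θ X) (hγ : IsNodeFunctional γ)
    (hγ' : IsStrictlyLocal γ) (hg : Measurable g) (hg1 : ∀ θ, |g θ| ≤ 1)
    (hg0 : ∫ θ, g θ ∂Pr = 0) (t : ℕ) :
    ∫ ω, relativeSum γ g t (path X ω) (path Θ ω) ^ 2 ∂μ ≤ 1 := by
  have hHi : ∀ t (x : ℕ → 𝒜) (θ : ℕ → stdSimplex ℝ 𝒜),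
      0 ≤ (1 + totalWeight x θ t)⁻¹ ∧ (1 + totalWeight x θ t)⁻¹ ≤ 1 := fun t x θ =>
    ⟨inv_nonneg.2 (by linarith [totalWeight_nonneg x θ t]),
      inv_le_one_of_one_le₀ (by linarith [totalWeight_nonneg x θ t])⟩
  have hinv : ∀ t, Integrable (fun ω => (1 + totalWeight (path X ω) (path Θ ω) t)⁻¹) μ := fun t => by
    cases t with
    | zero => simp [totalWeight]
    | succ t =>
      exact hs.integrable_history (((isPredictable_totalWeight t).comp
        (f := fun h => (1 + h)⁻¹) (by fun_prop)).toIsHistory) (C := 1) fun x θ => by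
          rw [abs_of_nonneg (hHi _ x θ).1]; exact (hHi _ x θ).2
  have hsq := hs.integrable_sq_relativeSum hγ hγ' hg hg1
  -- The sharper bound keeps the telescoped term `(1 + H)⁻¹`, which the induction needs.
  have key : ∫ ω, relativeSum γ g t (path X ω) (path Θ ω) ^ 2 ∂μ
      ≤ ∫ ω, (1 - (1 + totalWeight (path X ω) (path Θ ω) t)⁻¹) ∂μ := by
    induction t with
    | zero => simp [relativeSum, totalWeight]
    | succ t ih =>
      let I : Ω → ℝ := fun ω => relativeWeight γ t (path X ω) (path Θ ω)
        * g (Θ (oldNodes (path X ω) t).length ω)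
      have hI : ∀ ω, I ω = relativeSum γ g (t + 1) (path X ω) (path Θ ω)
          - relativeSum γ g t (path X ω) (path Θ ω) := fun ω => by
        rw [relativeSum_succ, add_sub_cancel_left]
      have hcross : ∫ ω, relativeSum γ g t (path X ω) (path Θ ω) * I ω ∂μ = 0 :=
        hs.integral_mul_increment hγ hγ' hg hg1 hg0 (isPredictable_relativeSum hγ hγ' hg t)
          (relativeSum_abs_le hγ hg1 t)
      have hcross_int : Integrable (fun ω => 2 * (relativeSum γ g t (path X ω) (path Θ ω) * I ω))
          μ := by
        refine Integrable.const_mul ?_ 2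
        have h1 := (isPredictable_relativeSum hγ hγ' hg t).toIsHistory
        have h2 := (isPredictable_relativeSum hγ hγ' hg (t + 1)).toIsHistory
        simp only [hI]
        refine hs.integrable_history ((h1.mono t.le_succ).mul (h2.sub (h1.mono t.le_succ)))
          (C := t * ((t + 1 : ℕ) + t)) fun x θ => ?_
        rw [abs_mul]
        refine mul_le_mul (relativeSum_abs_le hγ hg1 t x θ) ((abs_sub _ _).trans
          (add_le_add (relativeSum_abs_le hγ hg1 _ x θ) (relativeSum_abs_le hγ hg1 t x θ)))
          (abs_nonneg _) (Nat.cast_nonneg t)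
      have hle : ∀ ω, relativeSum γ g (t + 1) (path X ω) (path Θ ω) ^ 2
          ≤ relativeSum γ g t (path X ω) (path Θ ω) ^ 2
            + 2 * (relativeSum γ g t (path X ω) (path Θ ω) * I ω)
            + ((1 + totalWeight (path X ω) (path Θ ω) t)⁻¹
              - (1 + totalWeight (path X ω) (path Θ ω) (t + 1))⁻¹) := fun ω => by
        have h1 : I ω ^ 2 ≤ relativeWeight γ t (path X ω) (path Θ ω) ^ 2 := by
          simp only [I]
          rw [mul_pow]
          exact mul_le_of_le_one_right (sq_nonneg _) ((sq_le_one_iff_abs_le_one _).2 (hg1 _))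
        have h2 := sq_relativeWeight_le hγ t (path X ω) (path Θ ω)
        have h3 : relativeSum γ g (t + 1) (path X ω) (path Θ ω)
            = relativeSum γ g t (path X ω) (path Θ ω) + I ω := by rw [hI]; ring
        rw [h3]
        nlinarith
      have hA : Integrable (fun ω => relativeSum γ g t (path X ω) (path Θ ω) ^ 2
            + 2 * (relativeSum γ g t (path X ω) (path Θ ω) * I ω)) μ := (hsq t).add hcross_int
      have hB : Integrable (fun ω => (1 + totalWeight (path X ω) (path Θ ω) t)⁻¹
              - (1 + totalWeight (path X ω) (path Θ ω) (t + 1))⁻¹) μ := (hinv t).sub (hinv (t + 1))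
      have h1 := integral_mono (hsq (t + 1)) (hA.add hB) hle
      have h2 : ∫ ω, (relativeSum γ g t (path X ω) (path Θ ω) ^ 2
            + 2 * (relativeSum γ g t (path X ω) (path Θ ω) * I ω)
            + ((1 + totalWeight (path X ω) (path Θ ω) t)⁻¹
              - (1 + totalWeight (path X ω) (path Θ ω) (t + 1))⁻¹)) ∂μ
          = ∫ ω, relativeSum γ g t (path X ω) (path Θ ω) ^ 2 ∂μ
            + (∫ ω, (1 + totalWeight (path X ω) (path Θ ω) t)⁻¹ ∂μ
            - ∫ ω, (1 + totalWeight (path X ω) (path Θ ω) (t + 1))⁻¹ ∂μ) := by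
        rw [integral_add hA hB, integral_add (hsq t) hcross_int, integral_const_mul, hcross,
          integral_sub (hinv t) (hinv (t + 1))]
        ring
      have h3 : ∀ t, ∫ ω, (1 - (1 + totalWeight (path X ω) (path Θ ω) t)⁻¹) ∂μ
          = 1 - ∫ ω, (1 + totalWeight (path X ω) (path Θ ω) t)⁻¹ ∂μ := fun t => by
        rw [integral_sub (integrable_const _) (hinv t)]; simp
      rw [h3] at ih ⊢
      have h4 := h1.trans_eq h2
      linarith
  refine key.trans ?_
  calc _ ≤ ∫ _, (1 : ℝ) ∂μ := integral_mono ((integrable_const _).sub (hinv t))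
        (integrable_const _) fun ω => by
          have := (hHi t (path X ω) (path Θ ω)).1
          exact sub_le_self _ this
    _ = 1 := by simp

/-- Doob's convergence theorem; the L¹ bound follows from the L² bound by `|y| ≤ (1 + y ^ 2) / 2`.
-/
lemma ae_tendsto_relativeSum (hs : IsSource Pr μ Θ X) (hγ : IsNodeFunctional γ)
    (hγ' : IsStrictlyLocal γ) (hg : Measurable g) (hg1 : ∀ θ, |g θ| ≤ 1)
    (hg0 : ∫ θ, g θ ∂Pr = 0) :
    ∀ᵐ ω ∂μ, ∃ c, Tendsto (fun t => relativeSum γ g t (path X ω) (path Θ ω)) atTop (𝓝 c) := by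
  obtain ⟨a₀⟩ := nonempty_alphabet Pr
  obtain ⟨θ₀⟩ := nonempty_of_isProbabilityMeasure Pr
  refine (hs.martingale_relativeSum hγ hγ' hg hg1 hg0 a₀ θ₀).submartingale.exists_ae_tendsto_of_bdd
    (R := 1) fun t => ?_
  have hint := hs.integrable_relativeSum hγ hγ' hg hg1 t
  have h1 := hs.integral_sq_relativeSum_le hγ hγ' hg hg1 hg0 t
  have hsq := hs.integrable_sq_relativeSum hγ hγ' hg hg1 t
  rw [eLpNorm_one_eq_lintegral_enorm, ← ofReal_integral_norm_eq_lintegral_enorm hint]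
  refine ENNReal.ofReal_le_of_le_toReal ?_
  simp only [ENNReal.coe_one, ENNReal.toReal_one]
  have h2 : ∫ ω, ‖relativeSum γ g t (path X ω) (path Θ ω)‖ ∂μ
      ≤ ∫ ω, (1 / 2 + 1 / 2 * relativeSum γ g t (path X ω) (path Θ ω) ^ 2) ∂μ := by
    refine integral_mono hint.norm ((integrable_const _).add (hsq.const_mul _)) fun ω => ?_
    simp only [Real.norm_eq_abs]
    rw [← sq_abs (relativeSum γ g t (path X ω) (path Θ ω))]
    nlinarith [sq_nonneg (|relativeSum γ g t (path X ω) (path Θ ω)| - 1)]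
  rw [integral_add (integrable_const _) (hsq.const_mul _), integral_const_mul] at h2
  simp only [integral_const, probReal_univ, smul_eq_mul, one_mul] at h2
  linarith

/-- The weighted sum of `γ * g` over the nodes in use is small compared with their total weight. -/
lemma ae_weighted_sum_le (hs : IsSource Pr μ Θ X) (hγ : IsNodeFunctional γ)
    (hγ' : IsStrictlyLocal γ) (hg : Measurable g) (hg1 : ∀ θ, |g θ| ≤ 1)
    (hg0 : ∫ θ, g θ ∂Pr = 0) :
    ∀ᵐ ω ∂μ, ∀ ε > 0, ∃ C, ∀ t, |∑ s ∈ Finset.range t, freshWeight (path X ω) (path Θ ω) s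
      * current γ (path X ω) (path Θ ω) s * g (B Θ X s ω)|
        ≤ ε * totalWeight (path X ω) (path Θ ω) t + C := by
  filter_upwards [hs.ae_tendsto_relativeSum hγ hγ' hg hg1 hg0] with ω ⟨c, hc⟩ ε hε
  have hH : ∀ t, 0 ≤ totalWeight (path X ω) (path Θ ω) t := totalWeight_nonneg _ _
  obtain ⟨C, hC⟩ := exists_bound_of_tendsto
    (a := fun t => 1 + totalWeight (path X ω) (path Θ ω) t)
    (monotone_nat_of_le_succ fun t => by
      rw [totalWeight_succ]; linarith [freshWeight_nonneg (path X ω) (path Θ ω) t])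
    (fun t => by linarith [hH t]) hc hε
  refine ⟨ε + C, fun t => ?_⟩
  have h1 := hC t
  have h2 : ∀ s, (1 + totalWeight (path X ω) (path Θ ω) (s + 1))
      * (relativeSum γ g (s + 1) (path X ω) (path Θ ω) - relativeSum γ g s (path X ω) (path Θ ω))
      = freshWeight (path X ω) (path Θ ω) s * current γ (path X ω) (path Θ ω) s
        * g (B Θ X s ω) := fun s => by
    have h3 : (1 + totalWeight (path X ω) (path Θ ω) (s + 1)) ≠ 0 := by linarith [hH (s + 1)]
    rw [relativeSum, relativeSum, Finset.sum_range_succ, add_sub_cancel_left, relativeWeight, B_eq]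
    field_simp
  simp only [h2] at h1
  linarith

end IsSource

end Source

/-! ### Replacing a function of `B t` by its mean -/

section Source

variable {𝒜 : Type*} [Fintype 𝒜] [DecidableEq 𝒜] [MeasurableSpace 𝒜] [MeasurableSingletonClass 𝒜]
  {Pr : Measure (stdSimplex ℝ 𝒜)} [IsProbabilityMeasure Pr]
  {Ω : Type*} [MeasurableSpace Ω] {μ : Measure Ω} [IsProbabilityMeasure μ]
  {Θ : ℕ → Ω → stdSimplex ℝ 𝒜} {X : ℕ → Ω → 𝒜}
  {γ : (List 𝒜 → stdSimplex ℝ 𝒜) → List 𝒜 → ℝ} {f : stdSimplex ℝ 𝒜 → ℝ}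

lemma isNodeFunctional_one :
    IsNodeFunctional fun (_ : List 𝒜 → stdSimplex ℝ 𝒜) (_ : List 𝒜) => (1 : ℝ) :=
  ⟨fun _ _ => zero_le_one, fun _ _ => le_rfl, fun _ _ _ _ => rfl, fun _ => measurable_const⟩

/-- The product sees the value at the node itself, so it is local but in general not strictly local.
-/
lemma IsNodeFunctional.mul_apply (hγ : IsNodeFunctional γ) (hf : Measurable f)
    (hf0 : ∀ θ, 0 ≤ f θ) (hf1 : ∀ θ, f θ ≤ 1) :
    IsNodeFunctional fun ϑ w => γ ϑ w * f (ϑ w) :=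
  ⟨fun _ _ => mul_nonneg (hγ.nonneg _ _) (hf0 _),
    fun _ _ => mul_le_one₀ (hγ.le_one _ _) (hf0 _) (hf1 _),
    fun ϑ ϑ' w h => by rw [hγ.isLocal ϑ ϑ' w h, h w (List.prefix_refl w)],
    fun w => (hγ.measurable w).mul (hf.comp (measurable_pi_apply w))⟩

lemma tendsto_sqrt_div : Tendsto (fun n : ℕ => (Nat.sqrt (2 * n) : ℝ) / n) atTop (𝓝 0) := by
  have h1 : Tendsto (fun n : ℕ => Real.sqrt (2 / n)) atTop (𝓝 0) := by
    have := (Real.continuous_sqrt.tendsto 0).comp (tendsto_const_div_atTop_nhds_zero_nat 2)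
    rwa [Real.sqrt_zero] at this
  refine squeeze_zero (fun n => by positivity) (fun n => ?_) h1
  refine Real.le_sqrt_of_sq_le ?_
  rcases Nat.eq_zero_or_pos n with rfl | hn
  · simp
  have hn' : (0 : ℝ) < n := by exact_mod_cast hn
  have h2 : (Nat.sqrt (2 * n) : ℝ) ^ 2 ≤ 2 * n := by exact_mod_cast Nat.sqrt_le' (2 * n)
  rw [div_pow, div_le_div_iff₀ (by positivity) hn']
  nlinarith

/-- The deterministic bound for the sum of `γ * (f - c)` over the nodes visited before time `n`. -/
lemma abs_sum_current_mul_le (hγ : IsNodeFunctional γ) (hf : Measurable f)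
    (hf0 : ∀ θ, 0 ≤ f θ) (hf1 : ∀ θ, f θ ≤ 1) {c : ℝ} (hc0 : 0 ≤ c) (hc1 : c ≤ 1)
    (x : ℕ → 𝒜) (θ : ℕ → stdSimplex ℝ 𝒜) {ε C : ℝ} (hε : 0 ≤ ε)
    (hC : ∀ t, |∑ s ∈ Finset.range t, freshWeight x θ s * current γ x θ s
      * (f (thetaAt x θ s (nodeAt x s)) - c)| ≤ ε * totalWeight x θ t + C) (n : ℕ) :
    |∑ t ∈ Finset.range n, current γ x θ t * (f (thetaAt x θ t (nodeAt x t)) - c)|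
      ≤ |∑ t ∈ Finset.range n, deviation (fun ϑ w => γ ϑ w * f (ϑ w)) (x t) x θ t|
        + |∑ t ∈ Finset.range n, deviation γ (x t) x θ t|
        + ε * (n + |∑ t ∈ Finset.range n, deviation (fun _ _ => 1) (x t) x θ t|)
        + (2 + ε) * (Nat.sqrt (2 * n) + 2 + (treeAt x n).card)
        + |C| * (treeAt x n).card := by
  have hγf := hγ.mul_apply hf hf0 hf1
  have b1 := abs_sum_current_sub_le x θ hγf.isLocal hγf.nonneg hγf.le_one n
  have b2 := abs_sum_current_sub_le x θ hγ.isLocal hγ.nonneg hγ.le_one n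
  have b3 := abs_sum_current_sub_le x θ (isNodeFunctional_one (𝒜 := 𝒜)).isLocal
    isNodeFunctional_one.nonneg isNodeFunctional_one.le_one n
  have b4 : |(∑ t ∈ Finset.range n, if EndsPhrase x t then
        remaining (fun ϑ w => γ ϑ w * f (ϑ w)) x θ (t + 1) [] else 0)
      - c * ∑ t ∈ Finset.range n, if EndsPhrase x t then remaining γ x θ (t + 1) [] else 0|
      ≤ ε * (∑ t ∈ Finset.range n, if EndsPhrase x t then
        remaining (fun _ _ => 1) x θ (t + 1) [] else 0) + |C| * (treeAt x n).card := by
    have h1 : ((∑ t ∈ Finset.range n, if EndsPhrase x t then 1 else 0 : ℕ) : ℝ)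
        ≤ (treeAt x n).card := by
      exact_mod_cast (Nat.le_succ _).trans (card_endsPhrase_lt x n).le
    rw [Finset.mul_sum, ← Finset.sum_sub_distrib]
    refine (Finset.abs_sum_le_sum_abs _ _).trans (le_trans ?_ (add_le_add_right
      (mul_le_mul_of_nonneg_left h1 (abs_nonneg C)) _))
    push_cast
    rw [Finset.mul_sum, Finset.mul_sum, ← Finset.sum_add_distrib]
    refine Finset.sum_le_sum fun t _ => ?_
    split_ifs with h
    · rw [remaining_nil x θ _ hγf.isLocal, remaining_nil x θ _ hγ.isLocal,
        remaining_nil x θ _ isNodeFunctional_one.isLocal, Finset.mul_sum,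
        ← Finset.sum_sub_distrib]
      -- The potential of the root at time `t + 1` includes the node labelled at that time, hence
      -- the sum over `range (t + 2)`.
      have h2 := (hC (t + 1 + 1)).trans (add_le_add_right (le_abs_self C) _)
      refine le_trans (le_of_eq ?_) (h2.trans (le_of_eq ?_))
      · congr 1
        refine Finset.sum_congr rfl fun s _ => ?_
        simp only [current]
        ring
      · simp [totalWeight, current]
    · simp
  have h0 : ∑ t ∈ Finset.range n, current γ x θ t * (f (thetaAt x θ t (nodeAt x t)) - c)
      = ∑ t ∈ Finset.range n, current (fun ϑ w => γ ϑ w * f (ϑ w)) x θ t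
        - c * ∑ t ∈ Finset.range n, current γ x θ t := by
    rw [Finset.mul_sum, ← Finset.sum_sub_distrib]
    refine Finset.sum_congr rfl fun t _ => ?_
    simp only [current]
    ring
  have h1 : ∑ t ∈ Finset.range n, current (fun _ _ => 1) x θ t = n := by simp [current]
  rw [h1] at b3
  rw [h0]
  set S₁ := ∑ t ∈ Finset.range n, current (fun ϑ w => γ ϑ w * f (ϑ w)) x θ t
  set S₂ := ∑ t ∈ Finset.range n, current γ x θ t
  set P₁ := ∑ t ∈ Finset.range n, if EndsPhrase x t then
        remaining (fun ϑ w => γ ϑ w * f (ϑ w)) x θ (t + 1) [] else 0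
  set P₂ := ∑ t ∈ Finset.range n, if EndsPhrase x t then remaining γ x θ (t + 1) [] else 0
  set P₃ := ∑ t ∈ Finset.range n, if EndsPhrase x t then
        remaining (fun _ _ => 1) x θ (t + 1) [] else 0
  set M₁ := ∑ t ∈ Finset.range n, deviation (fun ϑ w => γ ϑ w * f (ϑ w)) (x t) x θ t
  set M₂ := ∑ t ∈ Finset.range n, deviation γ (x t) x θ t
  set M₃ := ∑ t ∈ Finset.range n, deviation (fun _ _ => 1) (x t) x θ t
  set e : ℝ := Nat.sqrt (2 * n) + 2 + (treeAt x n).card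
  -- For `F = 1` the sum over time is exactly `n`, which controls the total weight summed over
  -- phrases.
  have c1 : ε * P₃ ≤ ε * (n + |M₃| + e) := by
    refine mul_le_mul_of_nonneg_left ?_ hε
    have := (abs_le.1 b3).1
    linarith [neg_abs_le M₃, (abs_le.1 b3).2]
  have c2 : |c * (S₂ - P₂ - M₂)| ≤ e := by
    rw [abs_mul, abs_of_nonneg hc0]
    exact (mul_le_of_le_one_left (abs_nonneg _) hc1).trans b2
  have c3 : |c * M₂| ≤ |M₂| := by
    rw [abs_mul, abs_of_nonneg hc0]
    exact mul_le_of_le_one_left (abs_nonneg _) hc1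
  have c4 : S₁ - c * S₂ = (S₁ - P₁ - M₁) - c * (S₂ - P₂ - M₂) + (P₁ - c * P₂) + M₁ - c * M₂ := by
    ring
  have d1 := abs_le.1 b1
  have d2 := abs_le.1 c2
  have d3 := abs_le.1 b4
  have d4 := abs_le.1 c3
  rw [c4, abs_le]
  constructor <;> linarith [neg_abs_le M₁, le_abs_self M₁]

/-- The deviations are small only along fourth powers. The sum itself has increments bounded by `1`,
so the gaps are filled at this stage. -/
lemma IsSource.ae_tendsto_sum_current_mul (hs : IsSource Pr μ Θ X) (hγ : IsNodeFunctional γ)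
    (hγ' : IsStrictlyLocal γ) (hf : Measurable f) (hf0 : ∀ θ, 0 ≤ f θ) (hf1 : ∀ θ, f θ ≤ 1) :
    ∀ᵐ ω ∂μ, Tendsto (fun n : ℕ => (∑ t ∈ Finset.range n,
      current γ (path X ω) (path Θ ω) t * (f (B Θ X t ω) - ∫ θ, f θ ∂Pr)) / n) atTop (𝓝 0) := by
  have hfi : Integrable f Pr := .of_bound hf.aestronglyMeasurable 1 (ae_of_all _ fun θ => by
    rw [Real.norm_eq_abs, abs_of_nonneg (hf0 θ)]; exact hf1 θ)
  set c := ∫ θ, f θ ∂Pr with hc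
  have hc0 : 0 ≤ c := integral_nonneg hf0
  have hc1 : c ≤ 1 := by
    calc c ≤ ∫ _, (1 : ℝ) ∂Pr := integral_mono hfi (integrable_const _) hf1
      _ = 1 := by simp
  have hg1 : ∀ θ, |f θ - c| ≤ 1 := fun θ => by
    rw [abs_le]; constructor <;> linarith [hf0 θ, hf1 θ]
  filter_upwards [hs.ae_weighted_sum_le hγ hγ' (hf.sub_const c) hg1
      (by rw [integral_sub hfi (integrable_const _)]; simp [hc]),
    hs.ae_tendsto_sum_deviation hγ, hs.ae_tendsto_sum_deviation (hγ.mul_apply hf hf0 hf1),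
    hs.ae_tendsto_sum_deviation isNodeFunctional_one] with ω hω h1 h2 h3
  refine tendsto_div_of_tendsto_pow_four (fun n => ?_) ?_
  · rw [Finset.sum_range_succ, add_sub_cancel_left, abs_mul]
    refine mul_le_one₀ ?_ (abs_nonneg _) (hg1 _)
    rw [abs_of_nonneg (show 0 ≤ current γ (path X ω) (path Θ ω) n from hγ.nonneg _ _)]
    exact hγ.le_one _ _
  rw [Metric.tendsto_atTop]
  intro ε hε
  -- One `ε / 2` is the coefficient of `n` in the deterministic bound; the other dominates all terms
  -- that vanish after division by `n`.
  obtain ⟨C, hC⟩ := hω (ε / 2) (by positivity)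
  have t4 := (tendsto_sqrt_div.add ((tendsto_const_div_atTop_nhds_zero_nat 2).add
    (tendsto_card_treeAt_div (path X ω)))).comp tendsto_pow_four_atTop
  have t5 := (tendsto_card_treeAt_div (path X ω)).comp tendsto_pow_four_atTop
  have t6 := ((((tendsto_zero_iff_abs_tendsto_zero _).1 h2).add
    ((tendsto_zero_iff_abs_tendsto_zero _).1 h1)).add
      (((tendsto_zero_iff_abs_tendsto_zero _).1 h3).const_mul (ε / 2))).add
      ((t4.const_mul (2 + ε / 2)).add (t5.const_mul |C|))
  simp only [add_zero, mul_zero] at t6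
  obtain ⟨N, hN⟩ := (t6.eventually_lt_const (show (0 : ℝ) < ε / 2 by positivity)).exists_forall_of_atTop
  refine ⟨N, fun j hj => ?_⟩
  have h5 := hN j hj
  have h6 := abs_sum_current_mul_le hγ hf hf0 hf1 hc0 hc1 (path X ω) (path Θ ω)
    (by positivity) hC ((j + 1) ^ 4)
  have hn : (0 : ℝ) < ((j + 1) ^ 4 : ℕ) := by positivity
  simp only [Function.comp_apply] at h5
  generalize hnn : (j + 1) ^ 4 = n at *
  simp only [abs_div, abs_of_pos hn] at h5
  rw [Real.dist_eq, sub_zero, abs_div, abs_of_pos hn, div_lt_iff₀ hn]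
  refine h6.trans_lt ?_
  have h7 := mul_lt_mul_of_pos_right h5 hn
  have e1 : ∀ a : ℝ, a / n * n = a := fun a => div_mul_cancel₀ a hn.ne'
  simp only [add_mul, mul_assoc, e1] at h7
  linarith

end Source

/-! ### Tuples as functionals of nodes -/

section Tuples

variable {𝒜 : Type*} [Fintype 𝒜] [DecidableEq 𝒜]

/-- The indicator of the event that the symbol is `z` and that the value lies in `S`. -/
noncomputable def matchInd (z : 𝒜) (S : Set (stdSimplex ℝ 𝒜)) (a : 𝒜) (θ : stdSimplex ℝ 𝒜) : ℝ :=
  if a = z then S.indicator (fun _ => 1) θ else 0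

/-- The indicator of the event that the tuple of length `r` that starts at time `i` consists of
the symbols `z` and of values in the sets `S`. -/
noncomputable def tupleInd (z : ℕ → 𝒜) (S : ℕ → Set (stdSimplex ℝ 𝒜)) (r : ℕ) (x : ℕ → 𝒜)
    (b : ℕ → stdSimplex ℝ 𝒜) (i : ℕ) : ℝ :=
  ∏ j ∈ Finset.range r, matchInd (z j) (S j) (x (i + j)) (b (i + j))

/-- The indicator of the event that the last `r` steps of the path to a node consist of the
symbols `z` and of values in the sets `S`. -/
noncomputable def suffixInd (z : ℕ → 𝒜) (S : ℕ → Set (stdSimplex ℝ 𝒜)) :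
    ℕ → (List 𝒜 → stdSimplex ℝ 𝒜) → List 𝒜 → ℝ
  | 0, _, _ => 1
  | r + 1, ϑ, w => suffixInd z S r ϑ w.dropLast *
      (w.getLast?.elim 0 fun a => matchInd (z r) (S r) a (ϑ w.dropLast))

variable {z : ℕ → 𝒜} {S : ℕ → Set (stdSimplex ℝ 𝒜)}

lemma indicator_one_nonneg {E : Type*} (S : Set E) (e : E) :
    0 ≤ S.indicator (fun _ => (1 : ℝ)) e := Set.indicator_nonneg (fun _ _ => zero_le_one) e

lemma indicator_one_le_one {E : Type*} (S : Set E) (e : E) :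
    S.indicator (fun _ => (1 : ℝ)) e ≤ 1 := Set.indicator_le_self' (fun _ _ => zero_le_one) e

lemma matchInd_nonneg (z : 𝒜) (S : Set (stdSimplex ℝ 𝒜)) (a : 𝒜) (θ : stdSimplex ℝ 𝒜) :
    0 ≤ matchInd z S a θ := by
  unfold matchInd; split_ifs
  · exact indicator_one_nonneg _ _
  · rfl

lemma matchInd_le_one (z : 𝒜) (S : Set (stdSimplex ℝ 𝒜)) (a : 𝒜) (θ : stdSimplex ℝ 𝒜) :
    matchInd z S a θ ≤ 1 := by
  unfold matchInd; split_ifs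
  · exact indicator_one_le_one _ _
  · exact zero_le_one

lemma measurable_matchInd (z : 𝒜) {S : Set (stdSimplex ℝ 𝒜)} (hS : MeasurableSet S) (a : 𝒜) :
    Measurable (matchInd z S a) := by
  unfold matchInd; split_ifs
  · exact measurable_const.indicator hS
  · exact measurable_const

lemma suffixInd_append (r : ℕ) (ϑ : List 𝒜 → stdSimplex ℝ 𝒜) (w : List 𝒜) (a : 𝒜) :
    suffixInd z S (r + 1) ϑ (w ++ [a]) = suffixInd z S r ϑ w * matchInd (z r) (S r) a (ϑ w) := by
  simp [suffixInd]

lemma suffixInd_nil (r : ℕ) (ϑ : List 𝒜 → stdSimplex ℝ 𝒜) : suffixInd z S (r + 1) ϑ [] = 0 := by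
  simp [suffixInd]

/-- Each step of the path is drawn from the value at its starting node, so the value at the endpoint
never enters. -/
lemma isStrictlyLocal_suffixInd (r : ℕ) : IsStrictlyLocal (suffixInd z S r) := by
  induction r with
  | zero => exact fun _ _ _ _ => rfl
  | succ r ih =>
    intro ϑ ϑ' w h
    induction w using List.reverseRecOn with
    | nil => rw [suffixInd_nil, suffixInd_nil]
    | append_singleton w a =>
      rw [suffixInd_append, suffixInd_append, h w [a] (by simp) rfl,
        ih ϑ ϑ' w fun v l _ hv => h v (l ++ [a]) (by simp) (by rw [← hv, List.append_assoc])]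

lemma isNodeFunctional_suffixInd (hS : ∀ i, MeasurableSet (S i)) (r : ℕ) :
    IsNodeFunctional (suffixInd z S r) := by
  have h01 : ∀ r ϑ w, 0 ≤ suffixInd z S r ϑ w ∧ suffixInd z S r ϑ w ≤ 1 := by
    intro r
    induction r with
    | zero => exact fun _ _ => ⟨zero_le_one, le_rfl⟩
    | succ r ih =>
      intro ϑ w
      induction w using List.reverseRecOn with
      | nil => rw [suffixInd_nil]; exact ⟨le_rfl, zero_le_one⟩
      | append_singleton w a =>
        rw [suffixInd_append]
        exact ⟨mul_nonneg (ih ϑ w).1 (matchInd_nonneg _ _ _ _),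
          mul_le_one₀ (ih ϑ w).2 (matchInd_nonneg _ _ _ _) (matchInd_le_one _ _ _ _)⟩
  refine ⟨fun ϑ w => (h01 r ϑ w).1, fun ϑ w => (h01 r ϑ w).2, fun ϑ ϑ' w h => ?_, ?_⟩
  · exact isStrictlyLocal_suffixInd r ϑ ϑ' w fun v l _ hv => h v ⟨l, hv⟩
  · induction r with
    | zero => exact fun _ => measurable_const
    | succ r ih =>
      intro w
      induction w using List.reverseRecOn with
      | nil => simp only [suffixInd_nil]; exact measurable_const
      | append_singleton w a =>
        simp only [suffixInd_append]
        exact (ih w).mul ((measurable_matchInd _ (hS r) a).comp (measurable_pi_apply w))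

lemma tupleInd_nonneg (r : ℕ) (x : ℕ → 𝒜) (b : ℕ → stdSimplex ℝ 𝒜) (i : ℕ) :
    0 ≤ tupleInd z S r x b i :=
  Finset.prod_nonneg fun _ _ => matchInd_nonneg _ _ _ _

lemma tupleInd_le_one (r : ℕ) (x : ℕ → 𝒜) (b : ℕ → stdSimplex ℝ 𝒜) (i : ℕ) :
    tupleInd z S r x b i ≤ 1 :=
  Finset.prod_le_one (fun _ _ => matchInd_nonneg _ _ _ _) fun _ _ => matchInd_le_one _ _ _ _

lemma tupleInd_succ (r : ℕ) (x : ℕ → 𝒜) (b : ℕ → stdSimplex ℝ 𝒜) (i : ℕ) :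
    tupleInd z S (r + 1) x b i
      = tupleInd z S r x b i * matchInd (z r) (S r) (x (i + r)) (b (i + r)) :=
  Finset.prod_range_succ _ _

/-- At deep nodes, the tuple that has just been read is a suffix of the path to the node. -/
lemma current_suffixInd (x : ℕ → 𝒜) (θ : ℕ → stdSimplex ℝ 𝒜) (r i : ℕ)
    (h : r ≤ (nodeAt x (i + r)).length) :
    current (suffixInd z S r) x θ (i + r)
      = tupleInd z S r x (fun t => thetaAt x θ t (nodeAt x t)) i := by
  induction r with
  | zero => simp [current, suffixInd, tupleInd]
  | succ r ih =>
    rw [← add_assoc] at h ⊢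
    rw [nodeAt_succ] at h
    split_ifs at h with h1
    · simp at h
    have h2 : r ≤ (nodeAt x (i + r)).length := by simpa using h
    have h3 : nodeAt x (i + r + 1) = nodeAt x (i + r) ++ [x (i + r)] := by
      rw [nodeAt_succ, if_neg h1]
    rw [tupleInd_succ, ← ih h2, current, h3, suffixInd_append,
      thetaAt_succ_of_mem x θ _ (nodeAt_mem_labelled x _), current]
    congr 1
    refine isStrictlyLocal_suffixInd r _ _ _ fun v l _ hv => thetaAt_succ_of_mem x θ _ ?_
    exact mem_labelled_of_append x _ (hv ▸ nodeAt_mem_labelled x _)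

end Tuples

/-! ### Frequencies of tuples -/

section Source

variable {𝒜 : Type*} [Fintype 𝒜] [DecidableEq 𝒜] [MeasurableSpace 𝒜] [MeasurableSingletonClass 𝒜]
  {Pr : Measure (stdSimplex ℝ 𝒜)} [IsProbabilityMeasure Pr]
  {Ω : Type*} [MeasurableSpace Ω] {μ : Measure Ω} [IsProbabilityMeasure μ]
  {Θ : ℕ → Ω → stdSimplex ℝ 𝒜} {X : ℕ → Ω → 𝒜}
  {γ : (List 𝒜 → stdSimplex ℝ 𝒜) → List 𝒜 → ℝ}
  {z : ℕ → 𝒜} {S : ℕ → Set (stdSimplex ℝ 𝒜)}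

lemma sum_mul_matchInd (θ : stdSimplex ℝ 𝒜) (z : 𝒜) (S : Set (stdSimplex ℝ 𝒜)) :
    ∑ a, θ a * matchInd z S a θ = S.indicator (fun θ => θ z) θ := by
  by_cases h : θ ∈ S <;> simp [matchInd, h]

lemma tendsto_shift_div {u : ℕ → ℝ} (h : Tendsto (fun n : ℕ => u n / n) atTop (𝓝 0)) (r : ℕ) :
    Tendsto (fun n : ℕ => u (n + r) / n) atTop (𝓝 0) := by
  have h1 : Tendsto (fun n : ℕ => ((n + r : ℕ) : ℝ) / n) atTop (𝓝 1) := by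
    have := (tendsto_const_div_atTop_nhds_zero_nat (r : ℝ)).const_add 1
    rw [add_zero] at this
    refine this.congr' ?_
    filter_upwards [eventually_gt_atTop 0] with n hn
    have : (n : ℝ) ≠ 0 := by positivity
    push_cast
    field_simp
  have h2 := ((tendsto_add_atTop_iff_nat r).2 h).mul h1
  rw [zero_mul] at h2
  refine h2.congr' ?_
  filter_upwards [eventually_gt_atTop 0] with n hn
  have h3 : (n : ℝ) ≠ 0 := by positivity
  have h4 : ((n + r : ℕ) : ℝ) ≠ 0 := by positivity
  field_simp

namespace IsSource

/-- The difference splits into the match minus its conditional mean given the past, a bounded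
martingale increment, and that conditional mean minus its average under the prior. -/
lemma ae_tendsto_sum_current_match (hs : IsSource Pr μ Θ X) (hγ : IsNodeFunctional γ)
    (hγ' : IsStrictlyLocal γ) (z : 𝒜) {S : Set (stdSimplex ℝ 𝒜)} (hS : MeasurableSet S) :
    ∀ᵐ ω ∂μ, Tendsto (fun n : ℕ => (∑ t ∈ Finset.range n, current γ (path X ω) (path Θ ω) t
      * (matchInd z S (X t ω) (B Θ X t ω) - ∫ θ, S.indicator (fun θ => θ z) θ ∂Pr)) / n)
        atTop (𝓝 0) := by
  have hf0 : ∀ θ, 0 ≤ S.indicator (fun θ : stdSimplex ℝ 𝒜 => θ z) θ := fun θ =>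
    Set.indicator_nonneg (fun _ _ => simplex_nonneg _ _) θ
  have hf1 : ∀ θ, S.indicator (fun θ : stdSimplex ℝ 𝒜 => θ z) θ ≤ 1 := fun θ =>
    (Set.indicator_le_self' (fun _ _ => simplex_nonneg _ _) θ).trans (simplex_le_one _ _)
  have hf := (measurable_simplex_apply z).indicator hS
  let d : ℕ → 𝒜 → (ℕ → 𝒜) → (ℕ → stdSimplex ℝ 𝒜) → ℝ := fun t a x θ => current γ x θ t
    * (matchInd z S a (thetaAt x θ t (nodeAt x t))
      - S.indicator (fun θ => θ z) (thetaAt x θ t (nodeAt x t)))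
  have h1 : ∀ t a, IsHistory t (d t a) := fun t a => (hγ.isHistory_current t).mul
    ((isHistory_thetaAt t (measurable_matchInd z hS a)).sub (isHistory_thetaAt t hf))
  have h2 : ∀ t a x θ, |d t a x θ| ≤ 1 := fun t a x θ => by
    rw [abs_mul, abs_of_nonneg (show 0 ≤ current γ x θ t from hγ.nonneg _ _)]
    refine mul_le_one₀ (hγ.le_one _ _) (abs_nonneg _) ?_
    rw [abs_le]
    constructor <;>
      linarith [matchInd_nonneg z S a (thetaAt x θ t (nodeAt x t)), hf0 (thetaAt x θ t (nodeAt x t)),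
        matchInd_le_one z S a (thetaAt x θ t (nodeAt x t)), hf1 (thetaAt x θ t (nodeAt x t))]
  have h3 : ∀ t x θ, ∑ a, thetaAt x θ t (nodeAt x t) a * d t a x θ = 0 := fun t x θ => by
    simp only [d, mul_left_comm _ (current γ x θ t), ← Finset.mul_sum, mul_sub,
      Finset.sum_sub_distrib, ← Finset.sum_mul, sum_mul_matchInd, simplex_sum, one_mul, sub_self]
  filter_upwards [hs.ae_tendsto_sum_div h1 h2 h3,
    hs.ae_tendsto_sum_current_mul hγ hγ' hf hf0 hf1] with ω a1 a2
  have a3 := a1.add a2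
  rw [add_zero] at a3
  refine a3.congr fun n => ?_
  rw [← add_div, ← Finset.sum_add_distrib]
  congr 1
  refine Finset.sum_congr rfl fun t _ => ?_
  simp only [d, ← B_eq]
  ring

/-- The empirical frequency of a tuple converges to the product of the probabilities. -/
lemma ae_tendsto_sum_tupleInd (hs : IsSource Pr μ Θ X) (z : ℕ → 𝒜)
    (hS : ∀ i, MeasurableSet (S i)) (r : ℕ) :
    ∀ᵐ ω ∂μ, Tendsto (fun n : ℕ => (∑ i ∈ Finset.range n,
      tupleInd z S r (path X ω) (fun t => B Θ X t ω) i) / n) atTop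
        (𝓝 (∏ j ∈ Finset.range r, ∫ θ, (S j).indicator (fun θ => θ (z j)) θ ∂Pr)) := by
  induction r with
  | zero =>
    refine ae_of_all _ fun ω => ?_
    simp only [tupleInd, Finset.range_zero, Finset.prod_empty, Finset.sum_const, Finset.card_range,
      nsmul_eq_mul, mul_one]
    refine tendsto_const_nhds.congr' ?_
    filter_upwards [eventually_gt_atTop 0] with n hn
    rw [div_self (by positivity)]
  | succ r ih =>
    filter_upwards [ih, hs.ae_tendsto_sum_current_match (isNodeFunctional_suffixInd hS r)
      (isStrictlyLocal_suffixInd (z := z) r) (z r) (hS r)] with ω h1 h2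
    rw [Finset.prod_range_succ]
    set c := ∫ θ, (S r).indicator (fun θ => θ (z r)) θ ∂Pr with hc
    have hc0 : 0 ≤ c := integral_nonneg fun θ =>
      Set.indicator_nonneg (fun _ _ => simplex_nonneg _ _) θ
    have hc1 : c ≤ 1 := by
      calc c ≤ ∫ _, (1 : ℝ) ∂Pr := integral_mono_of_nonneg (ae_of_all _ fun θ =>
            Set.indicator_nonneg (fun _ _ => simplex_nonneg _ _) θ) (integrable_const _)
            (ae_of_all _ fun θ => (Set.indicator_le_self' (fun _ _ => simplex_nonneg _ _) θ).trans
              (simplex_le_one _ _))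
        _ = 1 := by simp
    let φ : ℕ → ℝ := tupleInd z S r (path X ω) (fun t => B Θ X t ω)
    let m : ℕ → ℝ := fun t => matchInd (z r) (S r) (X t ω) (B Θ X t ω) - c
    let k : ℕ → ℝ := current (suffixInd z S r) (path X ω) (path Θ ω)
    have hm1 : ∀ t, |m t| ≤ 1 := fun t => by
      rw [abs_le]
      constructor <;> linarith [matchInd_nonneg (z r) (S r) (X t ω) (B Θ X t ω),
        matchInd_le_one (z r) (S r) (X t ω) (B Θ X t ω)]
    have hk0 : ∀ t, 0 ≤ k t := fun t => (isNodeFunctional_suffixInd hS r).nonneg _ _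
    have hk1 : ∀ t, k t ≤ 1 := fun t => (isNodeFunctional_suffixInd hS r).le_one _ _
    have hφk : ∀ i, |φ i - k (i + r)|
        ≤ ((if (nodeAt (path X ω) (i + r)).length < r then 1 else 0 : ℕ) : ℝ) := fun i => by
      have hφ0 : 0 ≤ φ i := tupleInd_nonneg _ _ _ _
      have hφ1 : φ i ≤ 1 := tupleInd_le_one _ _ _ _
      split_ifs with h
      · rw [Nat.cast_one, abs_le]
        constructor <;> linarith [hk0 (i + r), hk1 (i + r)]
      · have := current_suffixInd (z := z) (S := S) (path X ω) (path Θ ω) r i (not_lt.1 h)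
        simp only [φ, k, this, B_eq, sub_self, abs_zero, Nat.cast_zero, le_refl]
    -- `φ i` and `k (i + r)` differ only if the node at time `i + r` is shallower than `r`, which
    -- happens at most `r` times per phrase.
    have hbound : ∀ n, |∑ i ∈ Finset.range n, φ i * m (i + r)
        - (∑ t ∈ Finset.range (n + r), k t * m t - ∑ t ∈ Finset.range r, k t * m t)|
        ≤ r * (treeAt (path X ω) (n + r)).card := fun n => by
      have e1 : ∑ t ∈ Finset.range (n + r), k t * m t - ∑ t ∈ Finset.range r, k t * m t
          = ∑ i ∈ Finset.range n, k (i + r) * m (i + r) := by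
        rw [add_comm n r, Finset.sum_range_add, add_sub_cancel_left]
        exact Finset.sum_congr rfl fun i _ => by rw [add_comm]
      rw [e1, ← Finset.sum_sub_distrib]
      refine (Finset.abs_sum_le_sum_abs _ _).trans ?_
      calc _ ≤ ∑ i ∈ Finset.range n,
            ((if (nodeAt (path X ω) (i + r)).length < r then 1 else 0 : ℕ) : ℝ) := by
            refine Finset.sum_le_sum fun i _ => ?_
            rw [← sub_mul, abs_mul]
            exact (mul_le_of_le_one_right (abs_nonneg _) (hm1 _)).trans (hφk i)
        _ ≤ ((∑ t ∈ Finset.range (n + r),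
            if (nodeAt (path X ω) t).length < r then 1 else 0 : ℕ) : ℝ) := by
            rw [← Nat.cast_sum, Nat.cast_le, add_comm n r, Finset.sum_range_add]
            simp only [add_comm r]
            exact Nat.le_add_left _ _
        _ ≤ _ := by exact_mod_cast card_shallow_le (path X ω) r (n + r)
    have l1 := (tendsto_shift_div (tendsto_card_treeAt_div (path X ω)) r).const_mul (r : ℝ)
    rw [mul_zero] at l1
    have l2 : Tendsto (fun n : ℕ => (∑ i ∈ Finset.range n, φ i * m (i + r)
        - (∑ t ∈ Finset.range (n + r), k t * m t - ∑ t ∈ Finset.range r, k t * m t)) / n)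
        atTop (𝓝 0) := by
      refine squeeze_zero_norm (fun n => ?_) l1
      rw [Real.norm_eq_abs, abs_div, abs_of_nonneg (Nat.cast_nonneg (α := ℝ) n),
        ← mul_div_assoc]
      exact div_le_div_of_nonneg_right (hbound n) (Nat.cast_nonneg n)
    have l3 := (l2.add (tendsto_shift_div h2 r)).sub (tendsto_const_div_atTop_nhds_zero_nat
      (∑ t ∈ Finset.range r, k t * m t))
    have l4 := l3.add (h1.mul_const c)
    simp only [add_zero, sub_zero, zero_add] at l4
    refine l4.congr fun n => ?_
    -- Centring the last match leaves a negligible sum plus `c` times the frequency of the shorter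
    -- tuple.
    have e2 : ∑ i ∈ Finset.range n, tupleInd z S (r + 1) (path X ω) (fun t => B Θ X t ω) i
        = ∑ i ∈ Finset.range n, φ i * m (i + r) + (∑ i ∈ Finset.range n, φ i) * c := by
      rw [Finset.sum_mul, ← Finset.sum_add_distrib]
      refine Finset.sum_congr rfl fun i _ => ?_
      rw [tupleInd_succ]
      simp only [φ, m, path]
      ring
    rw [e2]
    simp only [φ, m, k]
    ring

end IsSource

/-! ### Translation between averages of indicators and measures -/

lemma real_inv_smul_sum_dirac {E : Type*} [MeasurableSpace E] (y : ℕ → E) {A : Set E}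
    (hA : MeasurableSet A) (n : ℕ) :
    ((n : ENNReal)⁻¹ • ∑ i ∈ Finset.range n, Measure.dirac (y i)).real A
      = (∑ i ∈ Finset.range n, A.indicator (fun _ => 1) (y i)) / n := by
  rw [measureReal_ennreal_smul_apply, div_eq_inv_mul]
  congr 1
  -- Also for `n = 0`: the extended inverse is infinite, but its `toReal` is `0`, like the real
  -- inverse.
  · simp
  · rw [Measure.real, Measure.coe_finsetSum, Finset.sum_apply, ENNReal.toReal_sum]
    · refine Finset.sum_congr rfl fun i _ => ?_
      rw [Measure.dirac_apply' _ hA]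
      by_cases h : y i ∈ A <;> simp [h]
    · exact fun i _ => measure_ne_top _ _

/-- The event that an `r`-tuple consists of the symbols `z` and of values in the sets `S`. -/
def sequenceEvent (z : ℕ → 𝒜) (S : ℕ → Set (stdSimplex ℝ 𝒜)) (r : ℕ) :
    Set ((Fin r → stdSimplex ℝ 𝒜) × (Fin r → 𝒜)) :=
  {p | p.2 = (fun j : Fin r => z j) ∧ ∀ j : Fin r, p.1 j ∈ S j}

lemma mem_sequenceEvent {r : ℕ} {p : (Fin r → stdSimplex ℝ 𝒜) × (Fin r → 𝒜)} :
    p ∈ sequenceEvent z S r ↔ ∀ j : Fin r, p.2 j = z j ∧ p.1 j ∈ S j := by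
  show (p.2 = (fun j : Fin r => z j) ∧ ∀ j : Fin r, p.1 j ∈ S j) ↔ _
  rw [funext_iff, forall_and]

lemma tupleInd_eq_indicator {r : ℕ} (x : ℕ → 𝒜) (b : ℕ → stdSimplex ℝ 𝒜) (i : ℕ) :
    tupleInd z S r x b i = (sequenceEvent z S r).indicator (fun _ => 1)
        (fun j => b (i + j), fun j => x (i + j)) := by
  classical
  rw [tupleInd, Finset.prod_range]
  simp only [matchInd, Set.indicator_apply, mem_sequenceEvent, ← ite_and]
  rw [Finset.prod_ite_zero]
  simp

lemma measurableSet_singleSequence {r : ℕ} (hS : ∀ i, MeasurableSet (S i)) :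
    MeasurableSet (sequenceEvent z S r) := by
  refine (measurable_snd (measurableSet_singleton _)).inter ?_
  show MeasurableSet {p : (Fin r → stdSimplex ℝ 𝒜) × (Fin r → 𝒜) | ∀ j : Fin r, p.1 j ∈ S j}
  rw [Set.ofPred_forall]
  exact MeasurableSet.iInter fun j => ((measurable_pi_apply j).comp measurable_fst) (hS j)

/-- Given the values, the event has probability `∏ 1_S(θ j) θ j (z j)`, whose integral over the
product measure factors. -/
lemma limitLaw_real {r : ℕ} (hS : ∀ i, MeasurableSet (S i)) :
    (limitLaw Pr r).real (sequenceEvent z S r)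
      = ∏ j ∈ Finset.range r, ∫ θ, (S j).indicator (fun θ => θ (z j)) θ ∂Pr := by
  have h1 : ∀ θ : Fin r → stdSimplex ℝ 𝒜, tupleKernel r θ (Prod.mk θ ⁻¹'
      sequenceEvent z S r)
      = ENNReal.ofReal (∏ j : Fin r, (S j).indicator (fun θ => θ (z j)) (θ j)) := by
    intro θ
    by_cases h : ∀ j : Fin r, θ j ∈ S j
    · have e1 : Prod.mk θ ⁻¹' sequenceEvent z S r = {fun j : Fin r => z j} := by
        ext y; simp [mem_sequenceEvent, h, funext_iff]
      rw [e1]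
      show Measure.pi (fun i => symbolLaw (θ i)) {fun j : Fin r => z j} = _
      rw [Measure.pi_singleton, ENNReal.ofReal_prod_of_nonneg fun j _ =>
        Set.indicator_nonneg (fun _ _ => simplex_nonneg _ _) _]
      refine Finset.prod_congr rfl fun j _ => ?_
      rw [symbolLaw_singleton, Set.indicator_of_mem (h j)]
    · have e1 : Prod.mk θ ⁻¹' sequenceEvent z S r = ∅ := by
        ext y
        simp only [Set.mem_preimage, mem_sequenceEvent, Set.mem_empty_iff_false, iff_false]
        exact fun hy => h fun j => (hy j).2
      rw [e1, measure_empty]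
      push Not at h
      obtain ⟨j, hj⟩ := h
      rw [Finset.prod_eq_zero (Finset.mem_univ j) (Set.indicator_of_notMem hj _),
        ENNReal.ofReal_zero]
  rw [limitLaw, Measure.real, Measure.compProd_apply (measurableSet_singleSequence hS)]
  simp only [h1]
  rw [← integral_eq_lintegral_of_nonneg_ae, integral_fintype_prod_eq_prod
    (fun (j : Fin r) θ => (S j).indicator (fun θ : stdSimplex ℝ 𝒜 => θ (z j)) θ),
    Finset.prod_range (fun j => ∫ θ, (S j).indicator (fun θ => θ (z j)) θ ∂Pr)]
  · exact ae_of_all _ fun θ => Finset.prod_nonneg fun j _ =>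
      Set.indicator_nonneg (fun _ _ => simplex_nonneg _ _) _
  · refine (Finset.measurable_prod _ fun j _ => ?_).aestronglyMeasurable
    exact ((measurable_simplex_apply (z j)).indicator (hS j)).comp (measurable_pi_apply j)

end Source

end LZ78

theorem mainTheorem1 {𝒜 : Type*} [Fintype 𝒜] [DecidableEq 𝒜] [MeasurableSpace 𝒜]
    [MeasurableSingletonClass 𝒜] (r : ℕ)
    (Pr : Measure (stdSimplex ℝ 𝒜)) [IsProbabilityMeasure Pr]
    {Ω : Type*} [MeasurableSpace Ω] (μ : Measure Ω) [IsProbabilityMeasure μ]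
    (Θ : ℕ → Ω → stdSimplex ℝ 𝒜) (X : ℕ → Ω → 𝒜) (hsource : LZ78.IsSource Pr μ Θ X) :
    (∀ A : Set ((Fin r → stdSimplex ℝ 𝒜) × (Fin r → 𝒜)), LZ78.IsSingleSequenceEvent A →
      ∀ᵐ ω ∂μ, Tendsto
        (fun n : ℕ => (LZ78.pairTupleMeasure r n (fun t => LZ78.B Θ X t ω) (fun t => X t ω)).real A)
        atTop (𝓝 ((LZ78.limitLaw Pr r).real A))) ∧
    (∀ᵐ ω ∂μ, ∀ a : Fin r → 𝒜, Tendsto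
      (fun n : ℕ => (LZ78.tupleMeasure r n (fun t => X t ω)).real {a})
      atTop (𝓝 (∏ i, ∫ θ, θ (a i) ∂Pr))) := by
  obtain ⟨a₀⟩ := LZ78.IsSource.nonempty_alphabet Pr
  -- Patterns are extended to infinite sequences, the form in which the induction on `r` is carried
  -- out; the padding is never read.
  have hext : ∀ x : Fin r → 𝒜, ∃ z : ℕ → 𝒜, x = fun j : Fin r => z j := fun x =>
    ⟨fun j => if hj : j < r then x ⟨j, hj⟩ else a₀, by ext j; simp⟩
  constructor
  · rintro A ⟨x, S, hS, rfl⟩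
    obtain ⟨z, rfl⟩ := hext x
    let S' : ℕ → Set (stdSimplex ℝ 𝒜) := fun j => if hj : j < r then S ⟨j, hj⟩ else Set.univ
    have hS' : ∀ j, MeasurableSet (S' j) := fun j => by
      by_cases hj : j < r
      · simp only [S', hj, dite_true]; exact hS _
      · simp only [S', hj, dite_false]; exact MeasurableSet.univ
    have hSS : S = fun j : Fin r => S' j := by funext j; simp [S']
    have hA : {p : (Fin r → stdSimplex ℝ 𝒜) × (Fin r → 𝒜) |
        p.2 = (fun j : Fin r => z j) ∧ ∀ i, p.1 i ∈ S i} = LZ78.sequenceEvent z S' r := by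
      rw [hSS]; rfl
    rw [hA, LZ78.limitLaw_real hS']
    filter_upwards [hsource.ae_tendsto_sum_tupleInd z hS' r] with ω hω
    refine hω.congr fun n => ?_
    rw [LZ78.pairTupleMeasure, LZ78.real_inv_smul_sum_dirac]
    · simp only [LZ78.tupleInd_eq_indicator]
    · exact LZ78.measurableSet_singleSequence hS'
  · rw [ae_all_iff]
    intro a
    obtain ⟨z, rfl⟩ := hext a
    -- Without constraints on the values, the mean of the indicator times `θ (z j)` becomes the mean
    -- of `θ (z j)`.
    filter_upwards [hsource.ae_tendsto_sum_tupleInd z (S := fun _ => Set.univ)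
      (fun _ => MeasurableSet.univ) r] with ω hω
    rw [Finset.prod_range] at hω
    simp only [Set.indicator_univ] at hω
    refine hω.congr fun n => ?_
    rw [LZ78.tupleMeasure, LZ78.real_inv_smul_sum_dirac _ (measurableSet_singleton _)]
    classical
    simp [LZ78.tupleInd_eq_indicator, Set.indicator_apply, LZ78.mem_sequenceEvent, funext_iff]
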